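/- Write permutations of $\{1,\dots,n\}$ in one-line notation $\pi=\pi_1\pi_2\cdots\pi_n$. Let $D(\pi)=\sum_{i=1}^n|\pi_i-i|$, let $I(\pi)$ be the number of pairs $i<j$ with $\pi_i>\pi_j$, and let $\operatorname{cyc}(\pi)$ be the number of cycles of $\pi$, fixed points included. Call $\pi$ shallow if $I(\pi)+(n-\operatorname{cyc}(\pi))=D(\pi)$, and say that $\pi$ avoids $231$ if there are no $i<j<k$ with $\pi_k<\pi_i<\pi_j$. A descent of $\pi$ is a position $i$ with $1\le i<n$ and $\pi_i>\pi_{i+1}$. For $n,k\ge 0$ let $t_{n,k}$ be the number of shallow $231$-avoiding permutations of $\{1,\dots,n\}$ with exactly $k$ descents (the empty permutation being counted by $t_{0,0}=1$), let $b_{n,k}$ be the number of those that satisfy $n\ge1$ and $\pi_1=n$, and let $c_{n,k}$ be the number of those that satisfy $n\ge2$, $\pi_1=n$ and $\pi_2=n-1$. Consider the formal power series $$T(x,t)=\sum_{n,k\ge0}t_{n,k}x^nt^k,\qquad B(x,t)=\sum_{n,k\ge0}b_{n,k}x^nt^k,\qquad C(x,t)=\sum_{n,k\ge0}c_{n,k}x^nt^k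 .$$ **Theorem.** In the field of fractions of $\mathbb{Q}[[x,t]]$, all the denominators below being nonzero, $$C(x,t)=t^2x^4+\frac{tx^2}{1-xt}+\frac{3t^3x^5}{(1-xt)^2},$$ $$B(x,t)=\frac{x+C(x,t)-\frac1t C(x,t)}{1-\frac1{xt}C(x,t)},$$ $$T(x,t)=\frac{1}{1-B(x,t)}.$$ -/

import Mathlib

/-! A permutation `π` of `{1, …, n}` is modelled by `π : Equiv.Perm (Fin n)`; positions and values
are shifted down by one, so that `π_{i+1} = π i + 1`. -/

namespace ShallowPerm

/-- The total displacement `D(π) = ∑ |π_i - i|`. -/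
def displacement {n : ℕ} (π : Equiv.Perm (Fin n)) : ℕ :=
  ∑ i : Fin n, ((π i : ℤ) - (i : ℤ)).natAbs

/-- The length (inversion number) `I(π)`: the number of pairs `i < j` with `π_i > π_j`. -/
def inversions {n : ℕ} (π : Equiv.Perm (Fin n)) : ℕ :=
  (Finset.univ.filter fun p : Fin n × Fin n => p.1 < p.2 ∧ π p.2 < π p.1).card

/-- `cyc(π)`: the number of cycles in the disjoint cycle decomposition, fixed points included. -/
def numCycles {n : ℕ} (π : Equiv.Perm (Fin n)) : ℕ :=
  π.partition.parts.card

/-- The reflection length `T(π) = n - cyc(π)` (always `cyc(π) ≤ n`). -/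
def reflectionLength {n : ℕ} (π : Equiv.Perm (Fin n)) : ℕ :=
  n - numCycles π

/-- `π` is shallow if `I(π) + T(π) = D(π)`. -/
def IsShallow {n : ℕ} (π : Equiv.Perm (Fin n)) : Prop :=
  inversions π + reflectionLength π = displacement π

/-- `π` avoids the pattern `231`: there are no `i < j < k` with `π_k < π_i < π_j`. -/
def Avoids231 {n : ℕ} (π : Equiv.Perm (Fin n)) : Prop :=
  ¬ ∃ i j k : Fin n, i < j ∧ j < k ∧ π k < π i ∧ π i < π j

/-- The number of descents: positions `i` with `i + 1 ≤ n` and `π_i > π_{i+1}`. -/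
def descents {n : ℕ} (π : Equiv.Perm (Fin n)) : ℕ :=
  (Finset.univ.filter fun i : Fin n => ∃ h : (i : ℕ) + 1 < n, π ⟨(i : ℕ) + 1, h⟩ < π i).card

/-- `n ≥ 1` and `π_1 = n`. -/
def StartsWithMax {n : ℕ} (π : Equiv.Perm (Fin n)) : Prop :=
  ∃ h : 0 < n, (π ⟨0, h⟩ : ℕ) + 1 = n

/-- `n ≥ 2`, `π_1 = n` and `π_2 = n - 1`. -/
def StartsWithMaxTwo {n : ℕ} (π : Equiv.Perm (Fin n)) : Prop :=
  StartsWithMax π ∧ ∃ h : 1 < n, (π ⟨1, h⟩ : ℕ) + 2 = n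

open Classical in
/-- `t_{n,k}`: the number of shallow 231-avoiding permutations of length `n` with `k` descents. -/
noncomputable def tCount (n k : ℕ) : ℕ :=
  (Finset.univ.filter fun π : Equiv.Perm (Fin n) =>
    IsShallow π ∧ Avoids231 π ∧ descents π = k).card

open Classical in
/-- `b_{n,k}`: those permutations counted by `t_{n,k}` with `π_1 = n`. -/
noncomputable def bCount (n k : ℕ) : ℕ :=
  (Finset.univ.filter fun π : Equiv.Perm (Fin n) =>
    IsShallow π ∧ Avoids231 π ∧ descents π = k ∧ StartsWithMax π).card

open Classical in
/-- `c_{n,k}`: those permutations counted by `t_{n,k}` with `π_1 π_2 = n (n - 1)`. -/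
noncomputable def cCount (n k : ℕ) : ℕ :=
  (Finset.univ.filter fun π : Equiv.Perm (Fin n) =>
    IsShallow π ∧ Avoids231 π ∧ descents π = k ∧ StartsWithMaxTwo π).card

/-- The bivariate generating function `∑_{n,k} a(n,k) x^n t^k`, a formal power series in
`x = X 0` and `t = X 1`. -/
noncomputable def genFun (a : ℕ → ℕ → ℕ) : MvPowerSeries (Fin 2) ℚ :=
  fun m => (a (m 0) (m 1) : ℚ)

/-- The field of fractions of `ℚ⟦x, t⟧`, in which the quotients of power series are taken. -/
abbrev SeriesField : Type := FractionRing (MvPowerSeries (Fin 2) ℚ)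

/-- The embedding `ℚ⟦x, t⟧ → Frac ℚ⟦x, t⟧`. -/
noncomputable abbrev toField : MvPowerSeries (Fin 2) ℚ →+* SeriesField :=
  algebraMap (MvPowerSeries (Fin 2) ℚ) SeriesField

/-- The indeterminate `x`, which marks length. -/
noncomputable def xVar : SeriesField := toField (MvPowerSeries.X 0)

/-- The indeterminate `t`, which marks descents. -/
noncomputable def tVar : SeriesField := toField (MvPowerSeries.X 1)

/-- `T(x,t) = ∑ t_{n,k} x^n t^k`. -/
noncomputable def genT : SeriesField := toField (genFun tCount)

/-- `B(x,t) = ∑ b_{n,k} x^n t^k`. -/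
noncomputable def genB : SeriesField := toField (genFun bCount)

/-- `C(x,t) = ∑ c_{n,k} x^n t^k`. -/
noncomputable def genC : SeriesField := toField (genFun cCount)

end ShallowPerm

open ShallowPerm

namespace ShallowPerm
open Equiv Equiv.Perm

/-! Put T = n - cyc and call D - I - T the defect. If h is the largest moved point and π j = h,
right multiplication by `swap j h` fixes h, lowers T by 1 and I by 1 + 2c, where c counts the
positions strictly between j and h with values strictly between π h and h. The defect drops by
2(min(h - j, h - π h) - 1 - c), which is nonnegative because c is bounded by both sides of this box.
Induction gives D ≥ I + T (`defect_nonneg`). If σ and τ act on two intervals with at most an end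
point in common, D, I and T are all additive on τσ; since defects are nonnegative, τσ is shallow
exactly when σ and τ are (`isShallow_wedge`).

Two decompositions follow. If a 231-avoiding π has its maximum at position j, the earlier entries
are exactly the values below j, so π is a direct sum of an arbitrary permutation and one starting
with its maximum: T = 1 + TB. If π starts with its maximum and the second largest value is neither
first nor second, then π = τσ, where σ starts with its maximum and τ starts with its two largest
values, their intervals sharing one point. The overlap costs one unit of length and one descent:
xt(B - x - C) = (B - x)C.

It remains to find C. For a permutation that starts with its two largest values and does not end
with its smallest, fixing the smallest and the largest value by two transpositions preserves
shallowness under one condition: the last entry is below every other entry after the smallest value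
(`isShallow_iff_mul_swap_mul_swap`). With 231-avoidance this leaves the decreasing word and words of
three decreasing runs: K largest values, a smallest, b middle ones. Iterating the criterion shows
that the latter are shallow exactly when K = 2, a = 1 or b = 1 (`IsThreeRuns.isShallow_iff`), and
counting them gives C. -/

/-! ### Reflection length and transpositions. -/

theorem card_cycleType_le {n : ℕ} (π : Perm (Fin n)) : π.cycleType.card ≤ π.support.card := by
  rw [← π.sum_cycleType]
  simpa using Multiset.card_nsmul_le_sum (s := π.cycleType) (a := 1)
    fun x hx => (one_lt_of_mem_cycleType hx).le

/-- Fixed points cancel in n - cyc. The additive form avoids the truncated subtraction. -/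
theorem reflectionLength_add_card_cycleType {n : ℕ} (π : Perm (Fin n)) :
    reflectionLength π + π.cycleType.card = π.support.card := by
  have h1 := card_cycleType_le π
  have h2 : π.support.card ≤ n := by simpa using Finset.card_le_univ π.support
  simp only [reflectionLength, numCycles, parts_partition, Multiset.card_add,
    Multiset.card_replicate, Fintype.card_fin]
  omega

theorem reflectionLength_mul_of_disjoint {n : ℕ} {σ τ : Perm (Fin n)} (h : σ.Disjoint τ) :
    reflectionLength (σ * τ) = reflectionLength σ + reflectionLength τ := by
  have h1 := reflectionLength_add_card_cycleType (σ * τ)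
  have h2 := reflectionLength_add_card_cycleType σ
  have h3 := reflectionLength_add_card_cycleType τ
  rw [h.cycleType_mul, Multiset.card_add, h.card_support_mul] at h1
  omega

theorem reflectionLength_one {n : ℕ} : reflectionLength (1 : Perm (Fin n)) = 0 := by
  simpa using reflectionLength_add_card_cycleType (1 : Perm (Fin n))

theorem reflectionLength_of_isCycle {n : ℕ} {c : Perm (Fin n)} (h : c.IsCycle) :
    reflectionLength c + 1 = c.support.card := by
  have := reflectionLength_add_card_cycleType c
  rwa [h.cycleType, Multiset.card_singleton] at this

theorem reflectionLength_swap_mul_of_isCycle {n : ℕ} {c : Perm (Fin n)} (h : c.IsCycle)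
    {x : Fin n} (hx : c x ≠ x) :
    reflectionLength c = reflectionLength (swap x (c x) * c) + 1 := by
  by_cases hxx : c (c x) = x
  · have hc : c = swap x (c x) := h.eq_swap_of_apply_apply_eq_self hx hxx
    have h1 : swap x (c x) * c = 1 := by
      conv_lhs => rw [show swap x (c x) * c = swap x (c x) * swap x (c x) by rw [← hc]]
      exact swap_mul_self _ _
    have h2 := reflectionLength_of_isCycle h
    rw [hc, card_support_swap (Ne.symm hx)] at h2
    rw [h1, reflectionLength_one]
    rw [hc]
    omega
  · have h1 := reflectionLength_of_isCycle (h.swap_mul hx hxx)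
    have h2 := reflectionLength_of_isCycle h
    rw [support_swap_mul_eq _ _ hxx, Finset.card_sdiff_of_subset (by simpa using hx)] at h1
    have := h.two_le_card_support
    simp at h1
    omega

/-- The transposition cuts x out of its cycle, which becomes one shorter; the other cycles are
disjoint from it and do not change. -/
theorem reflectionLength_swap_mul {n : ℕ} (π : Perm (Fin n)) {x : Fin n} (hx : π x ≠ x) :
    reflectionLength π = reflectionLength (swap x (π x) * π) + 1 := by
  set c := π.cycleOf x with hc
  have hcx : c x = π x := cycleOf_apply_self π x
  have hcyc : c.IsCycle := isCycle_cycleOf π hx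
  have hmem : c ∈ π.cycleFactorsFinset := by
    rw [hc, cycleOf_mem_cycleFactorsFinset_iff]; simpa using hx
  have hd : (π * c⁻¹).Disjoint c := disjoint_mul_inv_of_mem_cycleFactorsFinset hmem
  have hπ : c * (π * c⁻¹) = π := by rw [hd.symm.commute.eq]; group
  have hd' : (swap x (c x) * c).Disjoint (π * c⁻¹) := by
    refine Disjoint.mul_left ?_ hd.symm
    rw [disjoint_iff_disjoint_support, support_swap (by rw [hcx]; exact hx.symm)]
    refine Disjoint.mono_left ?_ (disjoint_iff_disjoint_support.1 hd.symm)
    intro y hy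
    simp only [Finset.mem_insert, Finset.mem_singleton] at hy
    rcases hy with rfl | rfl
    · rw [mem_support, hcx]; exact hx
    · rw [apply_mem_support, mem_support, hcx]; exact hx
  have h1 : swap x (π x) * π = (swap x (c x) * c) * (π * c⁻¹) := by
    rw [mul_assoc, hπ, hcx]
  rw [h1, reflectionLength_mul_of_disjoint hd']
  conv_lhs => rw [← hπ, reflectionLength_mul_of_disjoint hd.symm]
  have := reflectionLength_swap_mul_of_isCycle hcyc (x := x) (by rw [hcx]; exact hx)
  omega

theorem reflectionLength_mul_swap {n : ℕ} (π : Perm (Fin n)) {j h : Fin n} (hjh : j ≠ h)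
    (hj : π j = h ∨ π h = j) :
    reflectionLength π = reflectionLength (π * swap j h) + 1 := by
  rcases hj with hj | hj
  · have hx : π h ≠ h := fun e => hjh (π.injective (hj.trans e.symm))
    rw [reflectionLength_swap_mul π hx, mul_swap_eq_swap_mul, hj]
  · have hx : π j ≠ j := fun e => hjh (π.injective (e.trans hj.symm))
    rw [reflectionLength_swap_mul π hx, mul_swap_eq_swap_mul, hj, swap_comm]

theorem support_mul_swap_ssubset {n : ℕ} (π : Perm (Fin n)) {j x : Fin n} (hjx : j ≠ x)
    (hj : π j = x) : (π * swap j x).support ⊂ π.support := by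
  have hx : π x ≠ x := fun e => hjx (π.injective (hj.trans e.symm))
  rw [Finset.ssubset_iff_of_subset]
  · exact ⟨x, by simpa using hx, by simp [hj]⟩
  · intro y hy
    by_contra hy'
    rw [notMem_support] at hy'
    have h1 : y ≠ j := by rintro rfl; exact hjx (hy'.symm.trans hj)
    have h2 : y ≠ x := by rintro rfl; exact hx hy'
    simp [swap_apply_of_ne_of_ne h1 h2, hy'] at hy

/-- Reflection length is additive on products whose factors move at most one common point. -/
theorem reflectionLength_mul_of_inter_support {n : ℕ} (σ τ : Perm (Fin n)) (p : Fin n)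
    (h : ∀ x, x ≠ p → σ x = x ∨ τ x = x) :
    reflectionLength (σ * τ) = reflectionLength σ + reflectionLength τ := by
  induction hk : τ.support.card using Nat.strong_induction_on generalizing τ with
  | _ k ih =>
    by_cases hτ : τ = 1
    · simp [hτ, reflectionLength_one]
    · have : ∃ x, x ≠ p ∧ τ x ≠ x := by
        by_contra! hcon
        refine hτ (Equiv.ext fun x => ?_)
        by_cases hx : x = p
        · subst hx
          by_contra hne
          exact hne (τ.injective (hcon _ hne))
        · exact hcon x hx
      obtain ⟨x, hxp, hx⟩ := this
      have hσx : σ x = x := (h x hxp).resolve_right hx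
      -- As σ fixes x, both τ and σ * τ send j to x, so `swap j x` shortens both by one; and τ *
      -- swap j x has smaller support.
      set j := τ⁻¹ x with hjdef
      have hj : τ j = x := by simp [hjdef]
      have hjx : j ≠ x := fun e => hx (by rw [e] at hj; exact hj)
      have hss := support_mul_swap_ssubset τ hjx hj
      have h1 := reflectionLength_mul_swap τ hjx (Or.inl hj)
      have h2 := reflectionLength_mul_swap (σ * τ) hjx (Or.inl (by simp [hj, hσx]))
      have h3 := ih _ (hk ▸ Finset.card_lt_card hss) (τ * swap j x) (fun y hy => by
        rcases h y hy with h | h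
        · exact Or.inl h
        · right
          by_contra hne
          exact (mem_support.1 (hss.1 (mem_support.2 hne))) h) rfl
      rw [mul_assoc] at h2
      omega

/-! ### Inversions, displacement and the Diaconis–Graham inequality. -/

theorem sum_sum_eq_add_pair {n : ℕ} (f : Fin n → Fin n → ℕ) {j h : Fin n} (hjh : j ≠ h) :
    ∑ a, ∑ b, f a b =
      ∑ a ∈ (Finset.univ.erase j).erase h, ∑ b ∈ (Finset.univ.erase j).erase h, f a b
      + ∑ a ∈ (Finset.univ.erase j).erase h, (f a j + f a h + f j a + f h a)
      + (f j j + f j h + f h j + f h h) := by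
  have key : ∀ g : Fin n → ℕ,
      ∑ a, g a = ∑ a ∈ (Finset.univ.erase j).erase h, g a + g j + g h := by
    intro g
    have h1 := Finset.sum_erase_add Finset.univ g (Finset.mem_univ j)
    have h2 := Finset.sum_erase_add (Finset.univ.erase j) g
      (show h ∈ _ by simp [hjh.symm])
    omega
  rw [key]
  simp only [key, Finset.sum_add_distrib]
  ring

theorem inversions_eq_sum {n : ℕ} (π : Perm (Fin n)) :
    inversions π = ∑ a, ∑ b, if a < b ∧ π b < π a then 1 else 0 := by
  rw [inversions, Finset.card_filter, Fintype.sum_prod_type]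

/-- Besides the pair (j, h), only an entry i inside the box spanned by the two exchanged entries
changes its total: it loses its inversions with both j and h. -/
theorem inversions_mul_swap {n : ℕ} (π : Perm (Fin n)) {j h : Fin n} (hjh : j < h)
    (hπ : π h < π j) :
    inversions π = inversions (π * swap j h) + 1 +
      2 * (Finset.univ.filter fun i => j < i ∧ i < h ∧ π h < π i ∧ π i < π j).card := by
  rw [inversions_eq_sum, inversions_eq_sum, sum_sum_eq_add_pair _ hjh.ne,
    sum_sum_eq_add_pair _ hjh.ne]
  have hcard : (Finset.univ.filter fun i => j < i ∧ i < h ∧ π h < π i ∧ π i < π j).card =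
      ∑ i ∈ (Finset.univ.erase j).erase h,
        if j < i ∧ i < h ∧ π h < π i ∧ π i < π j then 1 else 0 := by
    rw [← Finset.card_filter]
    congr 1
    ext i
    simp only [Finset.mem_filter, Finset.mem_univ, true_and, Finset.mem_erase]
    constructor
    · rintro ⟨h1, h2, h3⟩
      exact ⟨⟨h2.ne, h1.ne', trivial⟩, h1, h2, h3⟩
    · exact fun h => h.2
  rw [hcard]
  have hS : ∀ a ∈ (Finset.univ.erase j).erase h, (π * swap j h) a = π a := by
    intro a ha
    simp only [Finset.mem_erase, Finset.mem_univ, and_true] at ha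
    simp [swap_apply_of_ne_of_ne ha.2 ha.1]
  have h1 : ∑ a ∈ (Finset.univ.erase j).erase h, ∑ b ∈ (Finset.univ.erase j).erase h,
        (if a < b ∧ (π * swap j h) b < (π * swap j h) a then 1 else 0) =
      ∑ a ∈ (Finset.univ.erase j).erase h, ∑ b ∈ (Finset.univ.erase j).erase h,
        (if a < b ∧ π b < π a then 1 else 0) :=
    Finset.sum_congr rfl fun a ha => Finset.sum_congr rfl fun b hb => by rw [hS a ha, hS b hb]
  have hj' : (π * swap j h) j = π h := by simp
  have hh' : (π * swap j h) h = π j := by simp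
  rw [h1, hj', hh', Finset.mul_sum]
  have h2 : ∑ a ∈ (Finset.univ.erase j).erase h,
        ((if a < j ∧ π j < π a then 1 else 0) + (if a < h ∧ π h < π a then 1 else 0) +
          (if j < a ∧ π a < π j then 1 else 0) + (if h < a ∧ π a < π h then 1 else 0)) =
      ∑ a ∈ (Finset.univ.erase j).erase h,
        ((if a < j ∧ π h < (π * swap j h) a then 1 else 0) +
          (if a < h ∧ π j < (π * swap j h) a then 1 else 0) +
          (if j < a ∧ (π * swap j h) a < π h then 1 else 0) +
          (if h < a ∧ (π * swap j h) a < π j then 1 else 0)) +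
      ∑ i ∈ (Finset.univ.erase j).erase h,
        2 * (if j < i ∧ i < h ∧ π h < π i ∧ π i < π j then 1 else 0) := by
    rw [← Finset.sum_add_distrib]
    refine Finset.sum_congr rfl fun a ha => ?_
    rw [hS a ha]
    simp only [Finset.mem_erase, Finset.mem_univ, and_true] at ha
    have e1 : π a ≠ π j := fun e => ha.2 (π.injective e)
    have e2 : π a ≠ π h := fun e => ha.1 (π.injective e)
    generalize π a = x at *
    generalize π j = y at *
    generalize π h = z at *
    rcases lt_or_gt_of_ne ha.1 with a1 | a1 <;> rcases lt_or_gt_of_ne ha.2 with a2 | a2 <;>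
    rcases lt_or_gt_of_ne e1 with a3 | a3 <;> rcases lt_or_gt_of_ne e2 with a4 | a4 <;>
      simp only [a1, a2, a3, a4, a1.not_gt, a2.not_gt, a3.not_gt, a4.not_gt, and_true,
        and_false, if_true, if_false] <;> omega
  rw [h2]
  simp only [hjh, hjh.not_gt, hπ, hπ.not_gt, lt_irrefl, and_true, and_false, if_true, if_false]
  omega

theorem displacement_mul_swap {n : ℕ} (π : Perm (Fin n)) {j h : Fin n} (hjh : j ≠ h) :
    displacement π + ((π h : ℤ) - j).natAbs + ((π j : ℤ) - h).natAbs =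
      displacement (π * swap j h) + ((π j : ℤ) - j).natAbs + ((π h : ℤ) - h).natAbs := by
  have key : ∀ g : Fin n → ℕ,
      ∑ a, g a = ∑ a ∈ (Finset.univ.erase j).erase h, g a + g j + g h := by
    intro g
    have h1 := Finset.sum_erase_add Finset.univ g (Finset.mem_univ j)
    have h2 := Finset.sum_erase_add (Finset.univ.erase j) g
      (show h ∈ _ by simp [hjh.symm])
    omega
  have hS : ∑ a ∈ (Finset.univ.erase j).erase h, (((π * swap j h) a : ℤ) - a).natAbs =
      ∑ a ∈ (Finset.univ.erase j).erase h, ((π a : ℤ) - a).natAbs := by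
    refine Finset.sum_congr rfl fun a ha => ?_
    simp only [Finset.mem_erase, Finset.mem_univ, and_true] at ha
    simp [swap_apply_of_ne_of_ne ha.2 ha.1]
  rw [displacement, displacement, key, key, hS]
  simp only [coe_mul, Function.comp_apply, swap_apply_left, swap_apply_right]
  omega

/-- The defect `D(π) - I(π) - T(π)` in the Diaconis–Graham inequality. -/
def defect {n : ℕ} (π : Perm (Fin n)) : ℤ :=
  displacement π - inversions π - reflectionLength π

theorem isShallow_iff_defect {n : ℕ} (π : Perm (Fin n)) : IsShallow π ↔ defect π = 0 := by
  unfold IsShallow defect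
  omega

theorem defect_one {n : ℕ} : defect (1 : Perm (Fin n)) = 0 := by
  have h1 : displacement (1 : Perm (Fin n)) = 0 := by simp [displacement]
  have h2 : inversions (1 : Perm (Fin n)) = 0 := by
    simp only [inversions, Finset.card_eq_zero, Finset.filter_eq_empty_iff]
    rintro ⟨a, b⟩ - ⟨h, h'⟩
    exact h.not_gt h'
  simp [defect, h1, h2, reflectionLength_one]

/-- Since a + b - |a - b| = 2 min(a, b), the difference of the defects is 2(min(h - j, h - π h) - 1
- c), with c the number of entries in the box. -/
theorem defect_mul_swap_of_apply_left {n : ℕ} (π : Perm (Fin n)) {j h : Fin n} (hjh : j < h)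
    (hj : π j = h) (hh : π h < h) :
    defect π = defect (π * swap j h) + ((h : ℤ) - j) + ((h : ℤ) - π h) - ((π h : ℤ) - j).natAbs - 2 -
      2 * (Finset.univ.filter fun i => j < i ∧ i < h ∧ π h < π i ∧ π i < h).card := by
  have h1 := reflectionLength_mul_swap π hjh.ne (Or.inl hj)
  have h2 := inversions_mul_swap π hjh (by rwa [hj])
  have h3 := displacement_mul_swap π hjh.ne
  rw [hj] at h2 h3
  simp only [defect]
  have : (j : ℕ) < h := hjh
  have : (π h : ℕ) < h := hh
  omega

/-- The mirror image, in which the small value j is made a fixed point. -/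
theorem defect_mul_swap_of_apply_right {n : ℕ} (π : Perm (Fin n)) {j h : Fin n} (hjh : j < h)
    (hh : π h = j) (hj : j < π j) :
    defect π = defect (π * swap j h) + ((h : ℤ) - j) + ((π j : ℤ) - j) - ((π j : ℤ) - h).natAbs - 2 -
      2 * (Finset.univ.filter fun i => j < i ∧ i < h ∧ j < π i ∧ π i < π j).card := by
  have h1 := reflectionLength_mul_swap π hjh.ne (Or.inr hh)
  have h2 := inversions_mul_swap π hjh (by rwa [hh])
  have h3 := displacement_mul_swap π hjh.ne
  rw [hh] at h2 h3
  simp only [defect]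
  have : (j : ℕ) < h := hjh
  have : (j : ℕ) < π j := hj
  omega

theorem card_filter_lt_lt {n : ℕ} (a b : Fin n) :
    (Finset.univ.filter fun i => a < i ∧ i < b).card = (b : ℕ) - a - 1 := by
  rw [← Fin.card_Ioo]
  congr 1
  ext; simp

theorem card_filter_apply {n : ℕ} (π : Perm (Fin n)) (P : Fin n → Prop) [DecidablePred P] :
    (Finset.univ.filter fun i => P (π i)).card = (Finset.univ.filter P).card := by
  rw [← Finset.card_map π.toEmbedding]
  congr 1
  ext x
  simp only [Finset.mem_map, Finset.mem_filter, Finset.mem_univ, true_and, toEmbedding_apply]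
  constructor
  · rintro ⟨a, h, rfl⟩; exact h
  · exact fun h => ⟨π⁻¹ x, by simpa using h, by simp⟩

theorem card_filter_box_le {n : ℕ} (π : Perm (Fin n)) (a b c d : Fin n) :
    (Finset.univ.filter fun i => a < i ∧ i < b ∧ c < π i ∧ π i < d).card ≤ (b : ℕ) - a - 1 ∧
    (Finset.univ.filter fun i => a < i ∧ i < b ∧ c < π i ∧ π i < d).card ≤ (d : ℕ) - c - 1 := by
  constructor
  · rw [← card_filter_lt_lt]
    apply Finset.card_le_card
    intro i; simp only [Finset.mem_filter, Finset.mem_univ, true_and]; tauto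
  · rw [← card_filter_lt_lt, ← card_filter_apply π (fun i => c < i ∧ i < d)]
    apply Finset.card_le_card
    intro i; simp only [Finset.mem_filter, Finset.mem_univ, true_and]; tauto

theorem defect_mul_swap_le {n : ℕ} (π : Perm (Fin n)) {j h : Fin n} (hjh : j < h)
    (hj : π j = h) (hh : π h < h) : defect (π * swap j h) ≤ defect π := by
  have h1 := defect_mul_swap_of_apply_left π hjh hj hh
  have h2 := card_filter_box_le π j h (π h) h
  have : (j : ℕ) < h := hjh
  have : (π h : ℕ) < h := hh
  omega

/-- The Diaconis–Graham inequality. -/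
theorem defect_nonneg {n : ℕ} (π : Perm (Fin n)) : 0 ≤ defect π := by
  induction hk : π.support.card using Nat.strong_induction_on generalizing π with
  | _ k ih =>
    by_cases hπ : π.support.Nonempty
    -- For the largest moved point h, both π⁻¹ h and π h are below h, as the transposition step
    -- requires.
    · set h := π.support.max' hπ with hdef
      have hh : π h ≠ h := mem_support.1 (π.support.max'_mem hπ)
      have hle : ∀ x, π x ≠ x → x ≤ h := fun x hx => π.support.le_max' x (mem_support.2 hx)
      set j := π⁻¹ h with hjdef
      have hj : π j = h := by simp [hjdef]
      have hjh : j ≠ h := fun e => hh (by rw [e] at hj; exact hj)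
      have hjlt : j < h := lt_of_le_of_ne (hle j (by rw [hj]; exact hjh.symm)) hjh
      have hhlt : π h < h := lt_of_le_of_ne (hle _ fun e => hh (π.injective e)) hh
      have h1 := ih _ (hk ▸ Finset.card_lt_card (support_mul_swap_ssubset π hjh hj)) _ rfl
      exact h1.trans (defect_mul_swap_le π hjlt hj hhlt)
    · have : π = 1 := support_eq_empty_iff.1 (Finset.not_nonempty_iff_eq_empty.1 hπ)
      rw [this, defect_one]

/-! ### Products of permutations of two intervals that share an end point. -/

theorem apply_le_of_fixed_above {n : ℕ} {σ : Perm (Fin n)} {p : Fin n}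
    (hσ : ∀ x, p < x → σ x = x) (x : Fin n) : (p < x ∧ σ x = x) ∨ (x ≤ p ∧ σ x ≤ p) := by
  rcases lt_or_ge p x with h | h
  · exact Or.inl ⟨h, hσ x h⟩
  · refine Or.inr ⟨h, ?_⟩
    by_contra! hlt
    have := σ.injective (hσ _ hlt)
    order

theorem le_apply_of_fixed_below {n : ℕ} {τ : Perm (Fin n)} {p : Fin n}
    (hτ : ∀ x, x < p → τ x = x) (x : Fin n) : (x < p ∧ τ x = x) ∨ (p ≤ x ∧ p ≤ τ x) := by
  rcases lt_or_ge x p with h | h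
  · exact Or.inl ⟨h, hτ x h⟩
  · refine Or.inr ⟨h, ?_⟩
    by_contra! hlt
    have := τ.injective (hτ _ hlt)
    order

section Wedge

variable {n : ℕ} {σ τ : Perm (Fin n)} {p : Fin n}

/-- Only the point sent to p by σ can be moved twice, and both moves go upwards, so the distances
add. -/
theorem displacement_wedge (hσ : ∀ x, p < x → σ x = x) (hτ : ∀ x, x < p → τ x = x) :
    displacement (τ * σ) = displacement σ + displacement τ := by
  have h1 : displacement τ = ∑ i, ((τ (σ i) : ℤ) - σ i).natAbs :=
    (Equiv.sum_comp σ fun i => ((τ i : ℤ) - i).natAbs).symm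
  rw [h1, displacement, displacement, ← Finset.sum_add_distrib]
  refine Finset.sum_congr rfl fun i _ => ?_
  have h2 := apply_le_of_fixed_above hσ i
  have h3 := le_apply_of_fixed_below hτ (σ i)
  simp only [coe_mul, Function.comp_apply]
  generalize τ (σ i) = y at *
  generalize σ i = x at *
  omega

theorem inversions_wedge (hσ : ∀ x, p < x → σ x = x) (hτ : ∀ x, x < p → τ x = x) :
    inversions (τ * σ) = inversions σ + inversions τ := by
  have h1 : inversions τ = ∑ a, ∑ b, if σ a < σ b ∧ τ (σ b) < τ (σ a) then 1 else 0 := by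
    rw [inversions_eq_sum, ← Equiv.sum_comp σ]
    refine Finset.sum_congr rfl fun a _ => ?_
    rw [← Equiv.sum_comp σ]
  rw [h1, inversions_eq_sum, inversions_eq_sum, ← Finset.sum_add_distrib]
  refine Finset.sum_congr rfl fun a _ => ?_
  rw [← Finset.sum_add_distrib]
  refine Finset.sum_congr rfl fun b _ => ?_
  have ha := apply_le_of_fixed_above hσ a
  have ha' := le_apply_of_fixed_below hτ (σ a)
  have hb := apply_le_of_fixed_above hσ b
  have hb' := le_apply_of_fixed_below hτ (σ b)
  have hab : σ a = σ b → a = b := fun h => σ.injective h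
  change (if a < b ∧ τ (σ b) < τ (σ a) then 1 else 0) =
    (if a < b ∧ σ b < σ a then 1 else 0) + (if σ a < σ b ∧ τ (σ b) < τ (σ a) then 1 else 0)
  have key : a < b ∧ τ (σ b) < τ (σ a) ↔
      (a < b ∧ σ b < σ a) ∨ (σ a < σ b ∧ τ (σ b) < τ (σ a)) := by omega
  by_cases h2 : a < b ∧ σ b < σ a
  · have h3 : ¬ (σ a < σ b ∧ τ (σ b) < τ (σ a)) := fun h => h.1.not_gt h2.2
    rw [if_pos (key.2 (Or.inl h2)), if_pos h2, if_neg h3]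
  · by_cases h3 : σ a < σ b ∧ τ (σ b) < τ (σ a)
    · rw [if_pos (key.2 (Or.inr h3)), if_neg h2, if_pos h3]
    · rw [if_neg fun h => (key.1 h).elim h2 h3, if_neg h2, if_neg h3]

theorem reflectionLength_wedge (hσ : ∀ x, p < x → σ x = x) (hτ : ∀ x, x < p → τ x = x) :
    reflectionLength (τ * σ) = reflectionLength σ + reflectionLength τ := by
  rw [reflectionLength_mul_of_inter_support τ σ p, add_comm]
  intro x hx
  rcases lt_or_gt_of_ne hx with h | h
  · exact Or.inl (hτ x h)
  · exact Or.inr (hσ x h)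

/-- A product of permutations of two intervals sharing an end point is shallow if and only if
both factors are. -/
theorem isShallow_wedge (hσ : ∀ x, p < x → σ x = x) (hτ : ∀ x, x < p → τ x = x) :
    IsShallow (τ * σ) ↔ IsShallow σ ∧ IsShallow τ := by
  -- The defects add, and a sum of two nonnegative numbers vanishes only if both do.
  have h1 := defect_nonneg σ
  have h2 := defect_nonneg τ
  have h3 : defect (τ * σ) = defect σ + defect τ := by
    simp only [defect, displacement_wedge hσ hτ, inversions_wedge hσ hτ,
      reflectionLength_wedge hσ hτ]
    push_cast
    ring
  simp only [isShallow_iff_defect]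
  omega

end Wedge

/-! ### Transport of permutations to an interval, and counts of the transported ones. -/

section Shift

variable {lo len N : ℕ} (h : lo + len ≤ N)

/-- The order-preserving bijection from `Fin len` onto the interval `[lo, lo + len)` of `Fin N`. -/
def intervalEquiv : Fin len ≃ {x : Fin N // lo ≤ (x : ℕ) ∧ (x : ℕ) < lo + len} where
  toFun i := ⟨⟨lo + i, by omega⟩, by simp⟩
  invFun x := ⟨x.1 - lo, by have := x.2; omega⟩
  left_inv i := by ext; simp
  right_inv x := by
    have := x.2
    ext
    simp only
    omega

/-- The point `lo + i` of `Fin N`. -/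
def place (i : Fin len) : Fin N := ⟨lo + i, by omega⟩

/-- A permutation of `Fin len` acting on the interval `[lo, lo + len)` of `Fin N`. -/
def shift (σ : Perm (Fin len)) : Perm (Fin N) := σ.extendDomain (intervalEquiv h)

theorem place_val (i : Fin len) : (place h i : ℕ) = lo + i := rfl

theorem place_lt_place {i j : Fin len} : place h i < place h j ↔ i < j := by
  rw [Fin.lt_def, Fin.lt_def, place_val, place_val]
  omega

theorem place_injective : Function.Injective (place h) := by
  intro i j hij
  simpa [place, Fin.ext_iff] using hij

theorem shift_place (σ : Perm (Fin len)) (i : Fin len) :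
    shift h σ (place h i) = place h (σ i) :=
  extendDomain_apply_image σ (intervalEquiv h) i

theorem shift_of_notMem (σ : Perm (Fin len)) {x : Fin N}
    (hx : (x : ℕ) < lo ∨ lo + len ≤ x) : shift h σ x = x :=
  extendDomain_apply_not_subtype σ (intervalEquiv h) (by omega)

theorem exists_place_or (x : Fin N) :
    (∃ i, place h i = x) ∨ ((x : ℕ) < lo ∨ lo + len ≤ x) := by
  by_cases hx : (x : ℕ) < lo ∨ lo + len ≤ x
  · exact Or.inr hx
  · refine Or.inl ⟨⟨x - lo, by omega⟩, ?_⟩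
    ext
    rw [place_val]
    simp only
    omega

/-- Points outside the interval are fixed and take part in no inversion. This confines inversions,
descents and 231 patterns to the interval. -/
theorem exists_place_of_apply_lt (σ : Perm (Fin len)) {x y : Fin N} (hxy : x < y)
    (hσ : shift h σ y < shift h σ x) : ∃ i j, place h i = x ∧ place h j = y := by
  rcases exists_place_or h x with ⟨i, rfl⟩ | hx <;> rcases exists_place_or h y with ⟨j, rfl⟩ | hy
  · exact ⟨i, j, rfl, rfl⟩
  · have e1 := shift_of_notMem h σ hy
    rw [e1, shift_place] at hσ
    have e2 := place_val h i
    have e3 := place_val h (σ i)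
    omega
  · have e1 := shift_of_notMem h σ hx
    rw [e1, shift_place] at hσ
    have e2 := place_val h j
    have e3 := place_val h (σ j)
    omega
  · have e1 := shift_of_notMem h σ hx
    have e2 := shift_of_notMem h σ hy
    order

theorem reflectionLength_shift (σ : Perm (Fin len)) :
    reflectionLength (shift h σ) = reflectionLength σ := by
  have h1 := reflectionLength_add_card_cycleType σ
  have h2 := reflectionLength_add_card_cycleType (shift h σ)
  rw [← sum_cycleType] at h1 h2
  rw [shift, cycleType_extendDomain] at h2
  rw [shift]
  omega

theorem displacement_shift (σ : Perm (Fin len)) :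
    displacement (shift h σ) = displacement σ := by
  symm
  refine Finset.sum_of_injOn (place h) (place_injective h).injOn (by simp) ?_ ?_
  · intro x _ hx
    rcases exists_place_or h x with ⟨i, rfl⟩ | hx'
    · exact absurd ⟨i, by simp, rfl⟩ hx
    · simp [shift_of_notMem h σ hx']
  · intro i _
    simp [shift_place, place_val]

theorem inversions_shift (σ : Perm (Fin len)) :
    inversions (shift h σ) = inversions σ := by
  symm
  refine Finset.card_bij (fun p _ => (place h p.1, place h p.2)) ?_ ?_ ?_
  · rintro ⟨a, b⟩ hab
    simpa [shift_place, place_lt_place] using hab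
  · rintro ⟨a, b⟩ _ ⟨c, d⟩ _ he
    simp only [Prod.mk.injEq] at he
    exact Prod.ext (place_injective h he.1) (place_injective h he.2)
  · rintro ⟨x, y⟩ hxy
    simp only [Finset.mem_filter, Finset.mem_univ, true_and] at hxy
    obtain ⟨i, j, rfl, rfl⟩ := exists_place_of_apply_lt h σ hxy.1 hxy.2
    exact ⟨(i, j), by simpa [shift_place, place_lt_place] using hxy, rfl⟩

theorem isShallow_shift (σ : Perm (Fin len)) : IsShallow (shift h σ) ↔ IsShallow σ := by
  rw [IsShallow, IsShallow, inversions_shift, reflectionLength_shift, displacement_shift]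

theorem descents_shift (σ : Perm (Fin len)) : descents (shift h σ) = descents σ := by
  symm
  refine Finset.card_bij (fun i _ => place h i) ?_ (fun _ _ _ _ he => place_injective h he) ?_
  · intro i hi
    simp only [Finset.mem_filter, Finset.mem_univ, true_and] at hi ⊢
    obtain ⟨h1, h2⟩ := hi
    refine ⟨by rw [place_val]; omega, ?_⟩
    have : (⟨place h i + 1, by rw [place_val]; omega⟩ : Fin N) = place h ⟨i + 1, h1⟩ := by
      ext; simp [place_val, add_assoc]
    rw [this, shift_place, shift_place, place_lt_place]
    exact h2
  · intro x hx
    simp only [Finset.mem_filter, Finset.mem_univ, true_and] at hx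
    obtain ⟨h1, h2⟩ := hx
    obtain ⟨i, j, rfl, hj⟩ := exists_place_of_apply_lt h σ (Fin.lt_def.2 (Nat.lt_succ_self _)) h2
    have hji : (j : ℕ) = i + 1 := by
      have := congrArg Fin.val hj
      simp only [place_val] at this
      omega
    refine ⟨i, ?_, rfl⟩
    simp only [Finset.mem_filter, Finset.mem_univ, true_and]
    rw [← hj, shift_place, shift_place, place_lt_place] at h2
    exact ⟨by omega, by convert h2; exact hji.symm⟩

theorem avoids231_shift (σ : Perm (Fin len)) : Avoids231 (shift h σ) ↔ Avoids231 σ := by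
  refine not_congr ⟨?_, ?_⟩
  · rintro ⟨x, y, z, h1, h2, h3, h4⟩
    obtain ⟨i, k, rfl, rfl⟩ := exists_place_of_apply_lt h σ (h1.trans h2) h3
    obtain ⟨j, _, rfl, _⟩ := exists_place_of_apply_lt h σ h2 (h3.trans h4)
    simp only [shift_place, place_lt_place] at *
    exact ⟨i, j, k, h1, h2, h3, h4⟩
  · rintro ⟨i, j, k, h1, h2, h3, h4⟩
    exact ⟨place h i, place h j, place h k, by
      simpa only [shift_place, place_lt_place] using ⟨h1, h2, h3, h4⟩⟩

theorem exists_shift_eq {τ : Perm (Fin N)}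
    (hτ : ∀ x : Fin N, (x : ℕ) < lo ∨ lo + len ≤ x → τ x = x) : ∃ σ, shift h σ = τ := by
  have hmem : ∀ x : Fin N, (lo ≤ (τ x : ℕ) ∧ (τ x : ℕ) < lo + len) ↔
      (lo ≤ (x : ℕ) ∧ (x : ℕ) < lo + len) := by
    intro x
    by_cases hx : lo ≤ (x : ℕ) ∧ (x : ℕ) < lo + len
    · refine ⟨fun _ => hx, fun _ => ?_⟩
      by_contra hx'
      have := τ.injective (hτ (τ x) (by omega))
      rw [this] at hx'
      exact hx' hx
    · rw [hτ x (by omega)]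
  refine ⟨(intervalEquiv h).permCongr.symm (τ.subtypePerm hmem), ?_⟩
  ext x
  by_cases hx : lo ≤ (x : ℕ) ∧ (x : ℕ) < lo + len
  · rw [shift, extendDomain_apply_subtype _ (intervalEquiv h) hx]
    simp
  · rw [shift_of_notMem h _ (by omega), hτ x (by omega)]

theorem shift_injective : Function.Injective (shift h : Perm (Fin len) → Perm (Fin N)) := by
  intro σ τ hστ
  ext i
  have := congrArg (fun π : Perm (Fin N) => π (place h i)) hστ
  simp only [shift_place] at this
  rw [place_injective h this]

theorem card_filter_shift {P : Perm (Fin len) → Prop} {Q : Perm (Fin N) → Prop}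
    [DecidablePred P] [DecidablePred Q]
    (hPQ : ∀ σ, Q (shift h σ) ↔ P σ)
    (hQ : ∀ τ, Q τ → ∀ x : Fin N, (x : ℕ) < lo ∨ lo + len ≤ x → τ x = x) :
    (Finset.univ.filter Q).card = (Finset.univ.filter P).card := by
  symm
  refine Finset.card_bij (fun σ _ => shift h σ) ?_ (fun _ _ _ _ he => shift_injective h he) ?_
  · intro σ hσ
    simpa [hPQ] using hσ
  · intro τ hτ
    simp only [Finset.mem_filter, Finset.mem_univ, true_and] at hτ
    obtain ⟨σ, rfl⟩ := exists_shift_eq h (hQ τ hτ)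
    exact ⟨σ, by simpa [hPQ] using hτ, rfl⟩

end Shift

/-- The shallow `231`-avoiding permutations with `k` descents which are supported on the interval
`[lo, lo + len)`. -/
structure IsBlock {N : ℕ} (lo len k : ℕ) (τ : Perm (Fin N)) : Prop where
  fixed : ∀ x : Fin N, (x : ℕ) < lo ∨ lo + len ≤ x → τ x = x
  shallow : IsShallow τ
  avoids : Avoids231 τ
  descents_eq : descents τ = k

theorem isBlock_shift {lo len N : ℕ} (h : lo + len ≤ N) (k : ℕ) (σ : Perm (Fin len)) :
    IsBlock lo len k (shift h σ) ↔ IsShallow σ ∧ Avoids231 σ ∧ descents σ = k := by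
  rw [← isShallow_shift h, ← avoids231_shift h, ← descents_shift h]
  exact ⟨fun H => ⟨H.2, H.3, H.4⟩, fun H => ⟨fun x hx => shift_of_notMem h σ hx, H.1, H.2.1, H.2.2⟩⟩

/-- The value at `lo + i` is the `(i + 1)`-st largest of the interval `[lo, lo + len)`. -/
def HasTopAt {N : ℕ} (lo len i : ℕ) (τ : Perm (Fin N)) : Prop :=
  ∀ x : Fin N, (x : ℕ) = lo + i → (τ x : ℕ) + (i + 1) = lo + len

theorem hasTopAt_shift {lo len N : ℕ} (h : lo + len ≤ N) {i : ℕ} (hi : i < len)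
    (σ : Perm (Fin len)) : HasTopAt lo len i (shift h σ) ↔ (σ ⟨i, hi⟩ : ℕ) + (i + 1) = len := by
  have h1 : ∀ x : Fin N, (x : ℕ) = lo + i ↔ x = place h ⟨i, hi⟩ := by
    intro x
    rw [Fin.ext_iff, place_val]
  simp only [HasTopAt, h1, forall_eq, shift_place, place_val]
  omega

open Classical in
theorem card_isBlock {lo len N : ℕ} (h : lo + len ≤ N) (k : ℕ) :
    (Finset.univ.filter fun τ : Perm (Fin N) => IsBlock lo len k τ).card = tCount len k :=
  card_filter_shift h (isBlock_shift h k) fun _ (hτ : IsBlock lo len k _) => hτ.fixed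

theorem startsWithMax_iff {n : ℕ} (h : 0 < n) (π : Perm (Fin n)) :
    StartsWithMax π ↔ (π ⟨0, h⟩ : ℕ) + (0 + 1) = n :=
  ⟨fun ⟨_, h⟩ => h, fun h' => ⟨h, h'⟩⟩

theorem startsWithMaxTwo_iff {n : ℕ} (h : 1 < n) (π : Perm (Fin n)) :
    StartsWithMaxTwo π ↔ (π ⟨0, by omega⟩ : ℕ) + (0 + 1) = n ∧ (π ⟨1, h⟩ : ℕ) + (1 + 1) = n :=
  ⟨fun ⟨⟨_, h1⟩, ⟨_, h2⟩⟩ => ⟨h1, h2⟩, fun h' => ⟨⟨_, h'.1⟩, ⟨h, h'.2⟩⟩⟩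

open Classical in
theorem card_isBlock_hasTopAt {lo len N : ℕ} (h : lo + len ≤ N) (hlen : 0 < len) (k : ℕ) :
    (Finset.univ.filter fun τ : Perm (Fin N) => IsBlock lo len k τ ∧ HasTopAt lo len 0 τ).card =
      bCount len k := by
  refine card_filter_shift h (fun σ => ?_) fun _ (hτ : IsBlock lo len k _ ∧ _) => hτ.1.fixed
  rw [isBlock_shift, hasTopAt_shift h hlen, startsWithMax_iff hlen]
  tauto

open Classical in
theorem card_isBlock_hasTopAt_two {lo len N : ℕ} (h : lo + len ≤ N) (hlen : 1 < len) (k : ℕ) :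
    (Finset.univ.filter fun τ : Perm (Fin N) =>
      IsBlock lo len k τ ∧ HasTopAt lo len 0 τ ∧ HasTopAt lo len 1 τ).card = cCount len k := by
  refine card_filter_shift h (fun σ => ?_) fun _ (hτ : IsBlock lo len k _ ∧ _) => hτ.1.fixed
  rw [isBlock_shift, hasTopAt_shift h (by omega), hasTopAt_shift h hlen, startsWithMaxTwo_iff hlen]
  tauto

/-! ### Direct sums: splitting at the position of the maximum. -/

/-- Bookkeeping shared by both decompositions: `f` multiplies the two factors, and `i`, `j` are
their numbers of descents. -/
theorem card_eq_sum_antidiagonal {α : Type*} (S : Finset α) (X Y : ℕ → Finset α) (f : α → α → α)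
    (k : ℕ) (hX : ∀ a i i', a ∈ X i → a ∈ X i' → i = i') (hY : ∀ a i i', a ∈ Y i → a ∈ Y i' → i = i')
    (hmem : ∀ i j, i + j = k → ∀ a ∈ X i, ∀ b ∈ Y j, f a b ∈ S)
    (hinj : ∀ i j i' j', ∀ a ∈ X i, ∀ b ∈ Y j, ∀ a' ∈ X i', ∀ b' ∈ Y j', f a b = f a' b' →
      a = a' ∧ b = b')
    (hsurj : ∀ s ∈ S, ∃ i j, i + j = k ∧ ∃ a ∈ X i, ∃ b ∈ Y j, f a b = s) :
    S.card = ∑ q ∈ Finset.HasAntidiagonal.antidiagonal k, (X q.1).card * (Y q.2).card := by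
  simp only [← Finset.card_product]
  rw [← Finset.card_sigma]
  symm
  refine Finset.card_bij (fun x _ => f x.2.1 x.2.2) ?_ ?_ ?_
  · rintro ⟨⟨i, j⟩, a, b⟩ h
    simp only [Finset.mem_sigma, Finset.HasAntidiagonal.mem_antidiagonal, Finset.mem_product] at h
    exact hmem i j h.1 a h.2.1 b h.2.2
  · rintro ⟨⟨i, j⟩, a, b⟩ h ⟨⟨i', j'⟩, a', b'⟩ h' he
    simp only [Finset.mem_sigma, Finset.HasAntidiagonal.mem_antidiagonal, Finset.mem_product] at h h'
    obtain ⟨rfl, rfl⟩ := hinj i j i' j' a h.2.1 b h.2.2 a' h'.2.1 b' h'.2.2 he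
    obtain rfl := hX a i i' h.2.1 h'.2.1
    obtain rfl := hY b j j' h.2.2 h'.2.2
    rfl
  · intro s hs
    obtain ⟨i, j, hij, a, ha, b, hb, rfl⟩ := hsurj s hs
    exact ⟨⟨(i, j), a, b⟩, by simp [hij, ha, hb], rfl⟩

/-- A permutation preserving the initial interval `[0, j)` is a product of a permutation of
`[0, j)` and a permutation of its complement. -/
theorem exists_mul_of_mapsTo {n : ℕ} (π : Perm (Fin n)) (j : ℕ)
    (hπ : ∀ x : Fin n, (x : ℕ) < j → (π x : ℕ) < j) :
    ∃ σ τ : Perm (Fin n), (∀ x : Fin n, j ≤ x → σ x = x) ∧ (∀ x : Fin n, (x : ℕ) < j → τ x = x) ∧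
      τ * σ = π := by
  have hiff : ∀ x : Fin n, (π x : ℕ) < j ↔ (x : ℕ) < j := by
    refine fun x => ⟨fun h => ?_, hπ x⟩
    simpa using perm_symm_on_of_perm_on_finite (f := π) (p := fun x : Fin n => (x : ℕ) < j) hπ h
  set σ : Perm (Fin n) := ofSubtype (π.subtypePerm (p := fun x : Fin n => (x : ℕ) < j) hiff) with hσ
  have h1 : ∀ x : Fin n, (x : ℕ) < j → σ x = π x := fun x hx => by
    rw [hσ, ofSubtype_apply_of_mem (p := fun x : Fin n => (x : ℕ) < j) _ hx]; rfl
  have h2 : ∀ x : Fin n, j ≤ x → σ x = x := fun x hx =>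
    ofSubtype_apply_of_not_mem _ (by simpa using hx)
  refine ⟨σ, π * σ⁻¹, h2, fun x hx => ?_, by group⟩
  have h3 : ((σ⁻¹ x : Fin n) : ℕ) < j := by
    by_contra! hcon
    have := h2 _ hcon
    rw [show σ (σ⁻¹ x) = x by simp] at this
    rw [← this] at hcon
    omega
  rw [mul_apply, ← h1 _ h3]
  simp

section Sum

variable {n : ℕ} {σ τ : Perm (Fin n)} {j : ℕ}

theorem sum_apply_cases (hσ : ∀ x : Fin n, j ≤ x → σ x = x)
    (hτ : ∀ x : Fin n, (x : ℕ) < j → τ x = x) (x : Fin n) :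
    ((x : ℕ) < j ∧ (σ x : ℕ) < j ∧ τ (σ x) = σ x ∧ τ x = x) ∨
      (j ≤ x ∧ σ x = x ∧ j ≤ τ x ∧ τ (σ x) = τ x) := by
  rcases lt_or_ge (x : ℕ) j with hx | hx
  · have h1 : (σ x : ℕ) < j := by
      by_contra! h
      have := σ.injective (hσ _ h)
      rw [this] at h
      omega
    exact Or.inl ⟨hx, h1, hτ _ h1, hτ _ hx⟩
  · have h1 : j ≤ (τ x : ℕ) := by
      by_contra! h
      have := τ.injective (hτ _ h)
      rw [this] at h
      omega
    exact Or.inr ⟨hx, hσ x hx, h1, by rw [hσ x hx]⟩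

theorem avoids231_sum (hσ : ∀ x : Fin n, j ≤ x → σ x = x)
    (hτ : ∀ x : Fin n, (x : ℕ) < j → τ x = x) :
    Avoids231 (τ * σ) ↔ Avoids231 σ ∧ Avoids231 τ := by
  have key := sum_apply_cases hσ hτ
  constructor
  · refine fun H => ⟨?_, ?_⟩
    · rintro ⟨a, b, c, h1, h2, h3, h4⟩
      refine H ⟨a, b, c, h1, h2, ?_⟩
      have ha := key a
      have hb := key b
      have hc := key c
      change τ (σ c) < τ (σ a) ∧ τ (σ a) < τ (σ b)
      omega
    · rintro ⟨a, b, c, h1, h2, h3, h4⟩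
      refine H ⟨a, b, c, h1, h2, ?_⟩
      have ha := key a
      have hb := key b
      have hc := key c
      change τ (σ c) < τ (σ a) ∧ τ (σ a) < τ (σ b)
      omega
  · rintro ⟨H1, H2⟩ ⟨a, b, c, h1, h2, h3, h4⟩
    change τ (σ c) < τ (σ a) at h3
    change τ (σ a) < τ (σ b) at h4
    have ha := key a
    have hb := key b
    have hc := key c
    by_cases haj : (a : ℕ) < j
    · exact H1 ⟨a, b, c, h1, h2, by omega⟩
    · exact H2 ⟨a, b, c, h1, h2, by omega⟩

theorem descents_sum (hσ : ∀ x : Fin n, j ≤ x → σ x = x)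
    (hτ : ∀ x : Fin n, (x : ℕ) < j → τ x = x) :
    descents (τ * σ) = descents σ + descents τ := by
  have key := sum_apply_cases hσ hτ
  rw [descents, descents, descents, ← Finset.card_union_of_disjoint]
  · congr 1
    ext i
    simp only [Finset.mem_union, Finset.mem_filter, Finset.mem_univ, true_and, mul_apply]
    by_cases hi : (i : ℕ) + 1 < n
    · simp only [hi, exists_true_left]
      have h1 := key i
      obtain ⟨y, hy⟩ : ∃ y : Fin n, y = ⟨i + 1, hi⟩ := ⟨_, rfl⟩
      have hy' : (y : ℕ) = i + 1 := by rw [hy]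
      have h2 := key y
      rw [← hy]
      omega
    · simp [hi]
  · rw [Finset.disjoint_filter]
    rintro i - ⟨hi, h1⟩ ⟨_, h2⟩
    have h3 := key i
    obtain ⟨y, hy⟩ : ∃ y : Fin n, y = ⟨i + 1, hi⟩ := ⟨_, rfl⟩
    have hy' : (y : ℕ) = i + 1 := by rw [hy]
    have h4 := key y
    rw [← hy] at h1 h2
    omega

theorem eq_of_sum_eq {σ' τ' : Perm (Fin n)} (hσ : ∀ x : Fin n, j ≤ x → σ x = x)
    (hτ : ∀ x : Fin n, (x : ℕ) < j → τ x = x) (hσ' : ∀ x : Fin n, j ≤ x → σ' x = x)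
    (hτ' : ∀ x : Fin n, (x : ℕ) < j → τ' x = x) (h : τ * σ = τ' * σ') : σ = σ' ∧ τ = τ' := by
  have h1 : σ = σ' := by
    ext x
    have h2 := sum_apply_cases hσ hτ x
    have h3 := sum_apply_cases hσ' hτ' x
    have h4 : τ (σ x) = τ' (σ' x) := congrArg (fun π : Perm (Fin n) => π x) h
    omega
  subst h1
  exact ⟨rfl, mul_right_cancel h⟩

end Sum

/-- By 231-avoidance, each of the n - 1 - j values after position j lies strictly between π a and π
j; counting gives the bound. -/
theorem apply_lt_of_avoids231 {n : ℕ} {π : Perm (Fin n)} (hπ : Avoids231 π) {a j : Fin n}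
    (haj : a < j) (h : π a < π j) (hmax : ∀ b, j < b → π b < π j) :
    (π a : ℕ) + n ≤ π j + j := by
  have hsub : (Finset.univ.filter fun b => j < b) ⊆
      Finset.univ.filter fun b => π a < π b ∧ π b < π j := by
    intro b hb
    simp only [Finset.mem_filter, Finset.mem_univ, true_and] at hb ⊢
    refine ⟨?_, hmax b hb⟩
    by_contra! hle
    have : π b ≠ π a := fun e => by
      have := π.injective e
      omega
    exact hπ ⟨a, j, b, haj, hb, lt_of_le_of_ne hle this, h⟩
  have h1 := Finset.card_le_card hsub
  rw [card_filter_apply π (fun b => π a < b ∧ b < π j), card_filter_lt_lt] at h1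
  have h2 : (Finset.univ.filter fun b => j < b).card = n - 1 - j := by
    rw [← Fin.card_Ioi]
    congr 1
    ext; simp
  omega

-- With the maximum n - 1 at position j, the previous bound reads π a < j for all a < j, so [0, j)
-- is preserved and π splits as a direct sum.
open Classical in
theorem card_sum {n : ℕ} (j : Fin n) (k : ℕ) :
    (Finset.univ.filter fun π : Perm (Fin n) =>
      (IsShallow π ∧ Avoids231 π ∧ descents π = k) ∧ (π j : ℕ) + 1 = n).card =
    ∑ q ∈ Finset.HasAntidiagonal.antidiagonal k, tCount j q.1 * bCount (n - j) q.2 := by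
  have hj := j.2
  have e1 : ∀ i, tCount j i =
      (Finset.univ.filter fun σ : Perm (Fin n) => IsBlock 0 j i σ).card :=
    fun i => (card_isBlock (by omega) i).symm
  have e2 : ∀ i, bCount (n - j) i = (Finset.univ.filter fun τ : Perm (Fin n) =>
      IsBlock j (n - j) i τ ∧ HasTopAt j (n - j) 0 τ).card :=
    fun i => (card_isBlock_hasTopAt (by omega) (by omega) i).symm
  simp only [e1, e2]
  have fixσ : ∀ {i} {σ : Perm (Fin n)}, IsBlock 0 j i σ → ∀ x : Fin n, j ≤ (x : ℕ) → σ x = x :=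
    fun h x hx => h.fixed x (by omega)
  have fixτ : ∀ {i} {τ : Perm (Fin n)}, IsBlock j (n - j) i τ →
      ∀ x : Fin n, (x : ℕ) < j → τ x = x := fun h x hx => h.fixed x (Or.inl hx)
  refine card_eq_sum_antidiagonal _ (fun i => Finset.univ.filter fun σ : Perm (Fin n) =>
    IsBlock 0 j i σ) (fun i => Finset.univ.filter fun τ : Perm (Fin n) =>
      IsBlock j (n - j) i τ ∧ HasTopAt j (n - j) 0 τ) (fun σ τ => τ * σ) k ?_ ?_ ?_ ?_ ?_
  · intro a i i' h h'
    simp only [Finset.mem_filter, Finset.mem_univ, true_and] at h h'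
    rw [← h.descents_eq, h'.descents_eq]
  · intro a i i' h h'
    simp only [Finset.mem_filter, Finset.mem_univ, true_and] at h h'
    rw [← h.1.descents_eq, h'.1.descents_eq]
  · intro i i' hk σ hσ τ hτ
    simp only [Finset.mem_filter, Finset.mem_univ, true_and] at hσ hτ ⊢
    have f1 := fixσ hσ
    have f2 := fixτ hτ.1
    refine ⟨⟨(isShallow_wedge (p := j) (fun x hx => f1 x hx.le) f2).2 ⟨hσ.shallow, hτ.1.shallow⟩,
      (avoids231_sum f1 f2).2 ⟨hσ.avoids, hτ.1.avoids⟩, ?_⟩, ?_⟩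
    · rw [descents_sum f1 f2, hσ.descents_eq, hτ.1.descents_eq, hk]
    · rw [mul_apply, f1 j le_rfl]
      have := hτ.2 j rfl
      omega
  · intro i i' l l' σ hσ τ hτ σ' hσ' τ' hτ' he
    simp only [Finset.mem_filter, Finset.mem_univ, true_and] at hσ hτ hσ' hτ'
    exact eq_of_sum_eq (fixσ hσ) (fixτ hτ.1) (fixσ hσ') (fixτ hτ'.1) he
  · intro π hπ
    simp only [Finset.mem_filter, Finset.mem_univ, true_and] at hπ
    obtain ⟨⟨h1, h2, h3⟩, h4⟩ := hπ
    have hlt : ∀ b, b ≠ j → π b < π j := fun b hb => by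
      have := π.injective.ne hb
      omega
    obtain ⟨σ, τ, f1, f2, rfl⟩ := exists_mul_of_mapsTo π j fun x hx => by
      have := apply_lt_of_avoids231 h2 (a := x) (j := j) hx
        (hlt x (by omega)) fun b hb => hlt b (by omega)
      omega
    rw [isShallow_wedge (p := j) (fun x hx => f1 x hx.le) f2] at h1
    rw [avoids231_sum f1 f2] at h2
    rw [descents_sum f1 f2] at h3
    refine ⟨descents σ, descents τ, h3, σ, ?_, τ, ?_, rfl⟩
    · simp only [Finset.mem_filter, Finset.mem_univ, true_and]
      exact ⟨fun x hx => f1 x (by omega), h1.1, h2.1, rfl⟩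
    · simp only [Finset.mem_filter, Finset.mem_univ, true_and]
      refine ⟨⟨fun x hx => f2 x (by omega), h1.2, h2.2, rfl⟩, fun x hx => ?_⟩
      have : x = j := by omega
      subst this
      rw [mul_apply, f1 x le_rfl] at h4
      omega

theorem tCount_eq_sum {n : ℕ} (hn : 0 < n) (k : ℕ) :
    tCount n k = ∑ j : Fin n, ∑ q ∈ Finset.HasAntidiagonal.antidiagonal k, tCount j q.1 * bCount (n - j) q.2 := by
  classical
  simp only [← card_sum]
  rw [tCount, Finset.card_eq_sum_card_fiberwise (f := fun π : Perm (Fin n) =>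
    π⁻¹ ⟨n - 1, by omega⟩) (t := Finset.univ) (by simp [Set.MapsTo])]
  refine Finset.sum_congr rfl fun j _ => ?_
  rw [Finset.filter_filter]
  congr 1
  ext π
  simp only [Finset.mem_filter, Finset.mem_univ, true_and]
  rw [inv_eq_iff_eq, Fin.ext_iff]
  simp only
  constructor
  · rintro ⟨h1, h2⟩
    exact ⟨h1, by omega⟩
  · rintro ⟨h1, h2⟩
    exact ⟨h1, by omega⟩

/-! ### Gluing at a common point: splitting at the second largest value of a permutation that starts
with its maximum. -/

section Wedge

variable {n : ℕ} {σ τ : Perm (Fin n)} {p z : Fin n}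

theorem wedge_apply_cases (hσ : ∀ x, p < x → σ x = x) (hτ : ∀ x, x < p → τ x = x)
    (hz : (z : ℕ) = 0) (hσz : σ z = p) (hτp : (τ p : ℕ) + 1 = n) (x : Fin n) :
    (x = z ∧ σ x = p ∧ (τ (σ x) : ℕ) + 1 = n) ∨
      (z < x ∧ x ≤ p ∧ σ x < p ∧ τ (σ x) = σ x) ∨
      (p < x ∧ σ x = x ∧ p ≤ τ x ∧ (τ x : ℕ) + 1 < n ∧ τ (σ x) = τ x) := by
  rcases eq_or_ne x z with rfl | hxz
  · exact Or.inl ⟨rfl, hσz, by rw [hσz, hτp]⟩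
  · have h1 := apply_le_of_fixed_above hσ x
    have h2 : σ x ≠ p := fun e => hxz (σ.injective (e.trans hσz.symm))
    rcases lt_or_ge p x with hx | hx
    · have h3 := le_apply_of_fixed_below hτ x
      have h4 : τ x ≠ τ p := fun e => hx.ne' (τ.injective e)
      have h5 := hσ x hx
      exact Or.inr (Or.inr ⟨hx, h5, by omega, by omega, by rw [h5]⟩)
    · have h3 : σ x < p := by omega
      exact Or.inr (Or.inl ⟨by omega, hx, h3, hτ _ h3⟩)

theorem avoids231_wedge (hσ : ∀ x, p < x → σ x = x) (hτ : ∀ x, x < p → τ x = x)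
    (hz : (z : ℕ) = 0) (hσz : σ z = p) (hτp : (τ p : ℕ) + 1 = n) :
    Avoids231 (τ * σ) ↔ Avoids231 σ ∧ Avoids231 τ := by
  have key := wedge_apply_cases hσ hτ hz hσz hτp
  have keyτ := le_apply_of_fixed_below hτ
  have hp : ∀ x, x = p → (τ x : ℕ) + 1 = n := by rintro x rfl; exact hτp
  constructor
  · refine fun H => ⟨?_, ?_⟩
    · rintro ⟨a, b, c, h1, h2, h3, h4⟩
      refine H ⟨a, b, c, h1, h2, ?_⟩
      have ha := key a
      have hb := key b
      have hc := key c
      change τ (σ c) < τ (σ a) ∧ τ (σ a) < τ (σ b)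
      omega
    · rintro ⟨a, b, c, h1, h2, h3, h4⟩
      refine H ⟨a, b, c, h1, h2, ?_⟩
      have ha := key a
      have hb := key b
      have hc := key c
      have ha' := keyτ a
      have hb' := keyτ b
      have hc' := keyτ c
      have ha'' := hp a
      change τ (σ c) < τ (σ a) ∧ τ (σ a) < τ (σ b)
      omega
  · rintro ⟨H1, H2⟩ ⟨a, b, c, h1, h2, h3, h4⟩
    change τ (σ c) < τ (σ a) at h3
    change τ (σ a) < τ (σ b) at h4
    have ha := key a
    have hb := key b
    have hc := key c
    by_cases haj : a ≤ p
    · exact H1 ⟨a, b, c, h1, h2, by omega⟩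
    · exact H2 ⟨a, b, c, h1, h2, by omega⟩

/-- Position p is a descent of τ, which has its maximum there, but an ascent of τ * σ, whose value
at p is below p and is followed by a value at least p. No other descent is lost or created. -/
theorem descents_wedge (hσ : ∀ x, p < x → σ x = x) (hτ : ∀ x, x < p → τ x = x)
    (hz : (z : ℕ) = 0) (hσz : σ z = p) (hτp : (τ p : ℕ) + 1 = n) (hzp : z < p)
    (hpn : (p : ℕ) + 1 < n) :
    descents (τ * σ) + 1 = descents σ + descents τ := by
  have key := wedge_apply_cases hσ hτ hz hσz hτp
  have keyτ := le_apply_of_fixed_below hτ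
  have hp : ∀ x, x = p → (τ x : ℕ) + 1 = n := by rintro x rfl; exact hτp
  rw [descents, descents, descents, ← Finset.card_union_of_disjoint]
  · rw [← Finset.card_insert_of_notMem (a := p)]
    · congr 1
      ext i
      simp only [Finset.mem_insert, Finset.mem_union, Finset.mem_filter, Finset.mem_univ,
        true_and, mul_apply]
      by_cases hi : (i : ℕ) + 1 < n
      · simp only [hi, exists_true_left]
        obtain ⟨y, hy⟩ : ∃ y : Fin n, y = ⟨i + 1, hi⟩ := ⟨_, rfl⟩
        have hy' : (y : ℕ) = i + 1 := by rw [hy]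
        have h1 := key i
        have h2 := key y
        have h3 := keyτ i
        have h4 := keyτ y
        have h5 := hp i
        have h6 := hp y
        rw [← hy]
        omega
      · simp only [hi, IsEmpty.exists_iff, or_false, iff_false]
        rintro rfl
        exact hi hpn
    · simp only [Finset.mem_filter, Finset.mem_univ, true_and, mul_apply, hpn, exists_true_left]
      obtain ⟨y, hy⟩ : ∃ y : Fin n, y = ⟨p + 1, hpn⟩ := ⟨_, rfl⟩
      have hy' : (y : ℕ) = p + 1 := by rw [hy]
      have h1 := key p
      have h2 := key y
      rw [← hy]
      omega
  · rw [Finset.disjoint_filter]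
    rintro i - ⟨hi, h1⟩ ⟨_, h2⟩
    obtain ⟨y, hy⟩ : ∃ y : Fin n, y = ⟨i + 1, hi⟩ := ⟨_, rfl⟩
    have hy' : (y : ℕ) = i + 1 := by rw [hy]
    have h3 := key i
    have h4 := key y
    have h5 := keyτ i
    have h6 := keyτ y
    have h7 := hp y
    rw [← hy] at h1 h2
    omega

theorem eq_of_wedge_eq {σ' τ' : Perm (Fin n)} (hσ : ∀ x, p < x → σ x = x)
    (hτ : ∀ x, x < p → τ x = x) (hz : (z : ℕ) = 0) (hσz : σ z = p) (hτp : (τ p : ℕ) + 1 = n)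
    (hσ' : ∀ x, p < x → σ' x = x) (hτ' : ∀ x, x < p → τ' x = x) (hσz' : σ' z = p)
    (hτp' : (τ' p : ℕ) + 1 = n) (h : τ * σ = τ' * σ') : σ = σ' ∧ τ = τ' := by
  have h1 : σ = σ' := by
    ext x
    have h2 := wedge_apply_cases hσ hτ hz hσz hτp x
    have h3 := wedge_apply_cases hσ' hτ' hz hσz' hτp' x
    have h4 : τ (σ x) = τ' (σ' x) := congrArg (fun π : Perm (Fin n) => π x) h
    omega
  subst h1
  exact ⟨rfl, mul_right_cancel h⟩

theorem exists_wedge {π : Perm (Fin n)} (hz : (z : ℕ) = 0) (hπz : (π z : ℕ) + 1 = n)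
    (hπ : ∀ x, z < x → x ≤ p → π x < p) :
    ∃ σ τ : Perm (Fin n), (∀ x, p < x → σ x = x) ∧ (∀ x, x < p → τ x = x) ∧ σ z = p ∧
      (τ p : ℕ) + 1 = n ∧ τ * σ = π := by
  -- Exchanging the value π z for p makes [0, p] invariant; the transposition is given back to the
  -- second factor afterwards.
  obtain ⟨σ, ρ, h1, h2, h3⟩ := exists_mul_of_mapsTo (swap (π z) p * π) (p + 1) fun x hx => by
    rcases eq_or_ne x z with rfl | hxz
    · simp
    · have h4 : π x < p := hπ x (by omega) (by omega)
      rw [mul_apply, swap_apply_of_ne_of_ne (fun e => hxz (π.injective e)) h4.ne]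
      omega
  have h4 : σ z = p := by
    have h5 : ρ (σ z) = p := by rw [← mul_apply, h3]; simp
    have h6 := sum_apply_cases h1 h2 z
    rw [← h5]
    have : (z : ℕ) < p + 1 := by omega
    exact ((h6.resolve_right (by omega)).2.2.1).symm
  refine ⟨σ, swap (π z) p * ρ, fun x hx => h1 x hx, fun x hx => ?_, h4, ?_, ?_⟩
  · rw [mul_apply, h2 x (by omega), swap_apply_of_ne_of_ne _ hx.ne]
    have := p.2
    omega
  · rw [mul_apply, h2 p (by omega), swap_apply_right, hπz]
  · rw [mul_assoc, h3, ← mul_assoc, swap_mul_self, one_mul]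

end Wedge

-- The common point is p = j - 1, so the second block has length n - p = n + 1 - j, and its top two
-- values stand at p and j. The lost descent explains k + 1.
open Classical in
theorem card_wedge {n : ℕ} {j z : Fin n} (hz : (z : ℕ) = 0) (hj : 2 ≤ (j : ℕ)) (k : ℕ) :
    (Finset.univ.filter fun π : Perm (Fin n) =>
      (IsShallow π ∧ Avoids231 π ∧ descents π = k ∧ (π z : ℕ) + 1 = n) ∧
        (π j : ℕ) + 2 = n).card =
    ∑ q ∈ Finset.HasAntidiagonal.antidiagonal (k + 1), bCount j q.1 * cCount (n + 1 - j) q.2 := by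
  have hjn := j.2
  obtain ⟨p, hp⟩ : ∃ p : Fin n, (p : ℕ) + 1 = j := ⟨⟨j - 1, by omega⟩, by simp only; omega⟩
  have e1 : ∀ i, bCount j i = (Finset.univ.filter fun σ : Perm (Fin n) =>
      IsBlock 0 j i σ ∧ HasTopAt 0 j 0 σ).card :=
    fun i => (card_isBlock_hasTopAt (by omega) (by omega) i).symm
  have e2 : ∀ i, cCount (n + 1 - j) i = (Finset.univ.filter fun τ : Perm (Fin n) =>
      IsBlock p (n + 1 - j) i τ ∧ HasTopAt p (n + 1 - j) 0 τ ∧ HasTopAt p (n + 1 - j) 1 τ).card :=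
    fun i => (card_isBlock_hasTopAt_two (by omega) (by omega) i).symm
  simp only [e1, e2]
  have fixσ : ∀ {i} {σ : Perm (Fin n)}, IsBlock 0 j i σ → ∀ x : Fin n, p < x → σ x = x :=
    fun h x hx => h.fixed x (by omega)
  have fixτ : ∀ {i} {τ : Perm (Fin n)}, IsBlock p (n + 1 - j) i τ →
      ∀ x : Fin n, x < p → τ x = x := fun h x hx => h.fixed x (Or.inl hx)
  have topσ : ∀ {σ : Perm (Fin n)}, HasTopAt 0 j 0 σ → σ z = p := fun h => by
    have := h z (by omega)
    omega
  have topτ : ∀ {τ : Perm (Fin n)}, HasTopAt p (n + 1 - j) 0 τ → (τ p : ℕ) + 1 = n := fun h => by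
    have := h p rfl
    omega
  refine card_eq_sum_antidiagonal _ (fun i => Finset.univ.filter fun σ : Perm (Fin n) =>
    IsBlock 0 j i σ ∧ HasTopAt 0 j 0 σ) (fun i => Finset.univ.filter fun τ : Perm (Fin n) =>
      IsBlock p (n + 1 - j) i τ ∧ HasTopAt p (n + 1 - j) 0 τ ∧ HasTopAt p (n + 1 - j) 1 τ)
    (fun σ τ => τ * σ) (k + 1) ?_ ?_ ?_ ?_ ?_
  · intro a i i' h h'
    simp only [Finset.mem_filter, Finset.mem_univ, true_and] at h h'
    rw [← h.1.descents_eq, h'.1.descents_eq]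
  · intro a i i' h h'
    simp only [Finset.mem_filter, Finset.mem_univ, true_and] at h h'
    rw [← h.1.descents_eq, h'.1.descents_eq]
  · intro i i' hk σ hσ τ hτ
    simp only [Finset.mem_filter, Finset.mem_univ, true_and] at hσ hτ ⊢
    have f1 := fixσ hσ.1
    have f2 := fixτ hτ.1
    have t1 := topσ hσ.2
    have t2 := topτ hτ.2.1
    refine ⟨⟨(isShallow_wedge f1 f2).2 ⟨hσ.1.shallow, hτ.1.shallow⟩,
      (avoids231_wedge f1 f2 hz t1 t2).2 ⟨hσ.1.avoids, hτ.1.avoids⟩, ?_, ?_⟩, ?_⟩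
    · have := descents_wedge f1 f2 hz t1 t2 (by omega) (by omega)
      rw [hσ.1.descents_eq, hτ.1.descents_eq, hk] at this
      omega
    · rw [mul_apply, t1, t2]
    · rw [mul_apply, f1 j (by omega)]
      have := hτ.2.2 j (by omega)
      omega
  · intro i i' l l' σ hσ τ hτ σ' hσ' τ' hτ' he
    simp only [Finset.mem_filter, Finset.mem_univ, true_and] at hσ hτ hσ' hτ'
    exact eq_of_wedge_eq (fixσ hσ.1) (fixτ hτ.1) hz (topσ hσ.2) (topτ hτ.2.1) (fixσ hσ'.1)
      (fixτ hτ'.1) (topσ hσ'.2) (topτ hτ'.2.1) he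
  · intro π hπ
    simp only [Finset.mem_filter, Finset.mem_univ, true_and] at hπ
    obtain ⟨⟨h1, h2, h3, h0⟩, h4⟩ := hπ
    have hlt : ∀ b, b ≠ j → b ≠ z → π b < π j := fun b hb hb' => by
      have := π.injective.ne hb
      have := π.injective.ne hb'
      omega
    obtain ⟨σ, τ, f1, f2, t1, t2, rfl⟩ := exists_wedge (p := p) (π := π) hz h0 fun x hx hxp => by
      -- With π j = n - 2 the bound becomes π x ≤ j - 2, that is, π x < p.
      have := apply_lt_of_avoids231 h2 (a := x) (j := j) (by omega)
        (hlt x (by omega) (by omega)) fun b hb => hlt b (by omega) (by omega)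
      omega
    rw [isShallow_wedge f1 f2] at h1
    rw [avoids231_wedge f1 f2 hz t1 t2] at h2
    have h5 := descents_wedge f1 f2 hz t1 t2 (by omega) (by omega)
    refine ⟨descents σ, descents τ, by omega, σ, ?_, τ, ?_, rfl⟩
    · simp only [Finset.mem_filter, Finset.mem_univ, true_and]
      refine ⟨⟨fun x hx => f1 x (by omega), h1.1, h2.1, rfl⟩, fun x hx => ?_⟩
      have : x = z := by omega
      subst this
      rw [t1]
      omega
    · simp only [Finset.mem_filter, Finset.mem_univ, true_and]
      refine ⟨⟨fun x hx => f2 x (by omega), h1.2, h2.2, rfl⟩, fun x hx => ?_, fun x hx => ?_⟩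
      · have : x = p := by omega
        subst this
        omega
      · have : x = j := by omega
        subst this
        rw [mul_apply, f1 x (by omega)] at h4
        omega

theorem bCount_eq_sum {n : ℕ} (hn : 2 ≤ n) (k : ℕ) :
    bCount n k = cCount n k + ∑ j : Fin n, if 2 ≤ (j : ℕ) then
      ∑ q ∈ Finset.HasAntidiagonal.antidiagonal (k + 1), bCount j q.1 * cCount (n + 1 - j) q.2
      else 0 := by
  classical
  obtain ⟨z, hz⟩ : ∃ z : Fin n, z = ⟨0, by omega⟩ := ⟨_, rfl⟩
  have hz0 : (z : ℕ) = 0 := by rw [hz]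
  obtain ⟨y, hy⟩ : ∃ y : Fin n, y = ⟨1, hn⟩ := ⟨_, rfl⟩
  have hy1 : (y : ℕ) = 1 := by rw [hy]
  have hzy : z ≠ y := by omega
  have e1 : ∀ j : Fin n, (if 2 ≤ (j : ℕ) then ∑ q ∈ Finset.HasAntidiagonal.antidiagonal (k + 1),
      bCount j q.1 * cCount (n + 1 - j) q.2 else 0) = if 2 ≤ (j : ℕ) then
      (Finset.univ.filter fun π : Perm (Fin n) =>
      (IsShallow π ∧ Avoids231 π ∧ descents π = k ∧ (π z : ℕ) + 1 = n) ∧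
        (π j : ℕ) + 2 = n).card else 0 := fun j => by
    split_ifs with hj
    · rw [card_wedge hz0 hj]
    · rfl
  have e2 : bCount n k = (Finset.univ.filter fun π : Perm (Fin n) =>
      IsShallow π ∧ Avoids231 π ∧ descents π = k ∧ (π z : ℕ) + 1 = n).card := by
    rw [bCount]
    congr 1
    ext π
    simp only [Finset.mem_filter, startsWithMax_iff (show 0 < n by omega), ← hz, zero_add]
  have e3 : cCount n k = (Finset.univ.filter fun π : Perm (Fin n) =>
      (IsShallow π ∧ Avoids231 π ∧ descents π = k ∧ (π z : ℕ) + 1 = n) ∧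
        (π y : ℕ) + 2 = n).card := by
    rw [cCount]
    congr 1
    ext π
    simp only [Finset.mem_filter, startsWithMaxTwo_iff (show 1 < n by omega), ← hz, ← hy, zero_add]
    tauto
  rw [Finset.sum_congr rfl fun j _ => e1 j, e2, e3,
    Finset.card_eq_sum_card_fiberwise (f := fun π : Perm (Fin n) =>
    π⁻¹ ⟨n - 2, by omega⟩) (t := Finset.univ) (by simp [Set.MapsTo])]
  have e4 : ∀ j : Fin n, ((Finset.univ.filter fun π : Perm (Fin n) =>
      IsShallow π ∧ Avoids231 π ∧ descents π = k ∧ (π z : ℕ) + 1 = n).filter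
        fun π => π⁻¹ ⟨n - 2, by omega⟩ = j).card = (Finset.univ.filter fun π : Perm (Fin n) =>
      (IsShallow π ∧ Avoids231 π ∧ descents π = k ∧ (π z : ℕ) + 1 = n) ∧
        (π j : ℕ) + 2 = n).card := fun j => by
    rw [Finset.filter_filter]
    congr 1
    ext π
    simp only [Finset.mem_filter, Finset.mem_univ, true_and]
    rw [inv_eq_iff_eq, Fin.ext_iff]
    simp only
    constructor
    · rintro ⟨h1, h2⟩
      exact ⟨h1, by omega⟩
    · rintro ⟨h1, h2⟩
      exact ⟨h1, by omega⟩
  rw [Finset.sum_congr rfl fun j _ => e4 j, ← Finset.add_sum_erase _ _ (Finset.mem_univ y)]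
  congr 1
  rw [← Finset.add_sum_erase _ _ (Finset.mem_univ y), if_neg (by omega), zero_add]
  refine Finset.sum_congr rfl fun j hj => ?_
  simp only [Finset.mem_erase, Finset.mem_univ, and_true] at hj
  split_ifs with h
  · rfl
  -- Position 0 already holds the maximum, so this fibre is empty; the fibre of position 1 was split
  -- off as `cCount`.
  · have hjz : j = z := by omega
    rw [Finset.card_eq_zero, Finset.filter_eq_empty_iff]
    rintro π - ⟨h1, h2⟩
    rw [hjz] at h2
    omega

/-! ### Removing the extreme values of a permutation that starts with its two largest ones. -/

theorem card_filter_box_eq {n : ℕ} {π : Perm (Fin n)} {a b c d : Fin n}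
    (h : ∀ i, a < i → i < b → c < π i ∧ π i < d) :
    (Finset.univ.filter fun i => a < i ∧ i < b ∧ c < π i ∧ π i < d).card = (b : ℕ) - a - 1 := by
  rw [← card_filter_lt_lt]
  congr 1
  ext i
  simp only [Finset.mem_filter, Finset.mem_univ, true_and]
  exact ⟨fun H => ⟨H.1, H.2.1⟩, fun H => ⟨H.1, H.2, h i H.1 H.2⟩⟩

theorem apply_mem_of_fixed_outside {n : ℕ} {π : Perm (Fin n)} {l h : Fin n}
    (hfix : ∀ x, x < l ∨ h < x → π x = x) {x : Fin n} (h1 : l ≤ x) (h2 : x ≤ h) :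
    l ≤ π x ∧ π x ≤ h := by
  by_contra hcon
  have h3 := π.injective (hfix (π x) (by omega))
  omega

/-- The gain over d₂ is 2(min(h - q, h - m) - 1 - c). The bound on c through m has one unit to
spare, so the gain can vanish only through h - q. -/
theorem shallow_step_arith {d₁ d₂ : ℤ} {q h m c : ℕ}
    (h₁ : d₁ = d₂ + ((h : ℤ) - q) + ((h : ℤ) - m) - ((m : ℤ) - q).natAbs - 2 - 2 * c)
    (hd : 0 ≤ d₂) (hc : c + q + 1 ≤ h) (hc' : c + m + 2 ≤ h) :
    d₁ = 0 ↔ d₂ = 0 ∧ c + q + 1 = h := by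
  rcases le_total m q with hmq | hmq
  · rw [show (((m : ℤ) - q).natAbs : ℤ) = q - m by omega] at h₁
    omega
  · rw [show (((m : ℤ) - q).natAbs : ℤ) = m - q by omega] at h₁
    omega

theorem card_filter_box_eq_iff {n : ℕ} {π : Perm (Fin n)} {a b c d : Fin n} (hab : a < b)
    (hd : ∀ i, a < i → i < b → π i < d) :
    (Finset.univ.filter fun i => a < i ∧ i < b ∧ c < π i ∧ π i < d).card + a + 1 = b ↔
      ∀ i, a < i → i < b → c < π i := by
  constructor
  · intro h i h1 h2
    have c2 : (Finset.univ.filter fun i => a < i ∧ i < b).card ≤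
        (Finset.univ.filter fun i => a < i ∧ i < b ∧ c < π i ∧ π i < d).card := by
      rw [card_filter_lt_lt]
      omega
    have c3 := Finset.eq_of_subset_of_card_le (fun i => by
      simp only [Finset.mem_filter, Finset.mem_univ, true_and]; tauto) c2
    have c4 : i ∈ Finset.univ.filter fun i => a < i ∧ i < b := by simp [h1, h2]
    rw [← c3] at c4
    simp only [Finset.mem_filter, Finset.mem_univ, true_and] at c4
    exact c4.2.2.1
  · intro h
    rw [card_filter_box_eq fun i h1 h2 => ⟨h i h1 h2, hd i h1 h2⟩]
    omega

/-- Every position strictly between l and q lies in the box, so the box count attains its bound and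
nothing is lost. -/
theorem defect_mul_swap_of_apply_eq {n : ℕ} {π : Perm (Fin n)} {l q h : Fin n}
    (hl : π l = h) (hlq : l < q) (hqh : q < h) (hq : π q = l)
    (hbox : ∀ i, l < i → i < q → l < π i ∧ π i < h) :
    defect (π * swap l q) = defect π := by
  have d1 := defect_mul_swap_of_apply_right π hlq hq (by rw [hl]; exact hlq.trans hqh)
  rw [hl, card_filter_box_eq hbox] at d1
  have h1 : (l : ℕ) < q := hlq
  have h2 : (q : ℕ) < h := hqh
  rw [show (((h : ℕ) : ℤ) - (q : ℕ)).natAbs = (h : ℕ) - q by omega] at d1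
  omega

/-- Removing the largest and the smallest value from a permutation of `[l, h]` that begins with
`h, h - 1` and has its smallest value at `q`. -/
theorem isShallow_iff_mul_swap_mul_swap {n : ℕ} {π : Perm (Fin n)} {l y q h : Fin n}
    (hfix : ∀ x, x < l ∨ h < x → π x = x) (hl : π l = h) (hy : (π y : ℕ) + 1 = h)
    (hyl : (y : ℕ) = l + 1) (hyq : y < q) (hq : π q = l) (hqh : q < h) :
    IsShallow π ↔ IsShallow (π * swap l q * swap q h) ∧ ∀ i, q < i → i < h → π h < π i := by
  have hlq : l < q := by omega
  have nel : ∀ x, x ≠ l → π x ≠ h := fun x hx e => hx (π.injective (e.trans hl.symm))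
  have neq : ∀ x, x ≠ q → π x ≠ l := fun x hx e => hx (π.injective (e.trans hq.symm))
  have ney : ∀ x, x ≠ y → π x ≠ π y := fun x hx e => hx (π.injective e)
  have bd : ∀ x, l < x → x ≤ h → π x < h := fun x h1 h2 =>
    lt_of_le_of_ne (apply_mem_of_fixed_outside hfix h1.le h2).2 (nel x h1.ne')
  have bdq : ∀ x, l < x → x ≤ h → x ≠ q → l < π x := fun x h1 h2 h3 =>
    lt_of_le_of_ne (apply_mem_of_fixed_outside hfix h1.le h2).1 (neq x h3).symm
  have bdy : ∀ x, q < x → x ≤ h → π x < π y := fun x h1 h2 => by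
    have := bd x (hlq.trans h1) h2
    have := ney x (hyq.trans h1).ne'
    omega
  have e1 := defect_mul_swap_of_apply_eq hl hlq hqh hq fun i h1 h2 =>
    ⟨bdq i h1 (h2.trans hqh).le h2.ne, bd i h1 (h2.trans hqh).le⟩
  set ρ := π * swap l q with hρ
  have hρq : ρ q = h := by simp [hρ, hl]
  have hρi : ∀ i, q < i → ρ i = π i := fun i hi => by
    rw [hρ, mul_apply, swap_apply_of_ne_of_ne (hlq.trans hi).ne' hi.ne']
  have d2 := defect_mul_swap_of_apply_left ρ hqh hρq
    (by rw [hρi h hqh]; exact bd h (hlq.trans hqh) le_rfl)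
  -- The value h - 1 stands at y, to the left of q, so the box may be cut off at π y. This is the
  -- spare unit in `shallow_step_arith`.
  have e : (Finset.univ.filter fun i => q < i ∧ i < h ∧ π h < ρ i ∧ ρ i < h) =
      (Finset.univ.filter fun i => q < i ∧ i < h ∧ π h < π i ∧ π i < π y) := by
    refine Finset.filter_congr fun i _ => and_congr_right fun h1 => and_congr_right fun h2 => ?_
    rw [hρi i h1]
    exact and_congr_right fun _ =>
      iff_of_true (bd i (hlq.trans h1) h2.le) (bdy i h1 h2.le)
  rw [hρi h hqh, e] at d2
  have c1 := card_filter_box_le π q h (π h) (π y)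
  have hm : π h < π y := bdy h hqh le_rfl
  rw [isShallow_iff_defect, isShallow_iff_defect, ← e1, shallow_step_arith (q := q) (h := h)
    d2 (defect_nonneg _) (by omega) (by omega),
    card_filter_box_eq_iff hqh fun i h1 h2 => bdy i h1 h2.le]

/-! ### Words with three decreasing runs and their shallowness. -/

/-- `π` acts on the interval `[lo, lo + K + a + b)` as the word consisting of the `K` largest
values in decreasing order, the `a` smallest ones in decreasing order, and the `b` remaining ones
in decreasing order. -/
structure IsThreeRuns {N : ℕ} (π : Perm (Fin N)) (lo K a b : ℕ) : Prop where
  fixed : ∀ x : Fin N, (x : ℕ) < lo ∨ lo + K + a + b ≤ x → π x = x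
  large : ∀ x : Fin N, lo ≤ x → (x : ℕ) < lo + K → (π x : ℕ) + x + 1 = 2 * lo + K + a + b
  small : ∀ x : Fin N, lo + K ≤ x → (x : ℕ) < lo + K + a → (π x : ℕ) + x + 1 = 2 * lo + K + a
  mid : ∀ x : Fin N, lo + K + a ≤ x → (x : ℕ) < lo + K + a + b →
    (π x : ℕ) + x + 1 = 2 * lo + K + 2 * a + b

namespace IsThreeRuns

variable {N : ℕ} {π : Perm (Fin N)} {lo K a b : ℕ}

theorem cases (h : IsThreeRuns π lo K a b) (x : Fin N) :
    (((x : ℕ) < lo ∨ lo + K + a + b ≤ x) ∧ (π x : ℕ) = x) ∨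
    (lo ≤ x ∧ (x : ℕ) < lo + K ∧ (π x : ℕ) + x + 1 = 2 * lo + K + a + b) ∨
    (lo + K ≤ x ∧ (x : ℕ) < lo + K + a ∧ (π x : ℕ) + x + 1 = 2 * lo + K + a) ∨
    (lo + K + a ≤ x ∧ (x : ℕ) < lo + K + a + b ∧ (π x : ℕ) + x + 1 = 2 * lo + K + 2 * a + b) := by
  by_cases h1 : (x : ℕ) < lo ∨ lo + K + a + b ≤ x
  · exact Or.inl ⟨h1, by rw [h.fixed x h1]⟩
  · by_cases h2 : (x : ℕ) < lo + K
    · exact Or.inr (Or.inl ⟨by omega, h2, h.large x (by omega) h2⟩)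
    · by_cases h3 : (x : ℕ) < lo + K + a
      · exact Or.inr (Or.inr (Or.inl ⟨by omega, h3, h.small x (by omega) h3⟩))
      · exact Or.inr (Or.inr (Or.inr ⟨by omega, by omega, h.mid x (by omega) (by omega)⟩))

theorem unique {π' : Perm (Fin N)} (h : IsThreeRuns π lo K a b) (h' : IsThreeRuns π' lo K a b) :
    π = π' := by
  ext x
  have h1 := h.cases x
  have h2 := h'.cases x
  omega

theorem exists_of_le (h : lo + K + a + b ≤ N) : ∃ π : Perm (Fin N), IsThreeRuns π lo K a b := by
  set g : ℕ → ℕ := fun x => if x < lo then x else if x < lo + K then 2 * lo + K + a + b - 1 - x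
    else if x < lo + K + a then 2 * lo + K + a - 1 - x
    else if x < lo + K + a + b then 2 * lo + K + 2 * a + b - 1 - x else x with hg
  have hgN : ∀ x : Fin N, g x < N := fun x => by
    simp only [hg]
    split_ifs <;> omega
  set f : Fin N → Fin N := fun x => ⟨g x, hgN x⟩ with hf
  have hinj : Function.Injective f := fun x y hxy => by
    have h1 : g x = g y := congrArg Fin.val hxy
    simp only [hg] at h1
    split_ifs at h1 <;> omega
  refine ⟨Equiv.ofBijective f (Finite.injective_iff_bijective.1 hinj), ?_, ?_, ?_, ?_⟩ <;>
    intro x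
  · intro hx
    ext
    simp only [ofBijective_apply, hf, hg]
    split_ifs <;> omega
  all_goals
    intro hx hx'
    simp only [ofBijective_apply, hf, hg]
    split_ifs <;> omega

/-- The word is the reversal of an interval. Exchanging its two ends costs no defect, because the
box between them is full, and leaves the reversal of the inner interval. -/
theorem isShallow_of_zero (h : IsThreeRuns π lo K 0 0) (hN : lo + K ≤ N) : IsShallow π := by
  induction K using Nat.strong_induction_on generalizing lo π with
  | _ K ih =>
    rcases lt_or_ge K 2 with hK | hK
    · have : π = 1 := by
        ext x
        have := h.cases x
        simp only [one_apply]
        omega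
      rw [this, isShallow_iff_defect, defect_one]
    · obtain ⟨l, hl⟩ : ∃ l : Fin N, (l : ℕ) = lo := ⟨⟨lo, by omega⟩, rfl⟩
      obtain ⟨r, hr⟩ : ∃ r : Fin N, (r : ℕ) + 1 = lo + K :=
        ⟨⟨lo + K - 1, by omega⟩, by simp only; omega⟩
      have hlr : l < r := by omega
      have cl := h.cases l
      have cr := h.cases r
      have h1 : π l = r := by omega
      have h2 : π r = l := by omega
      have d := defect_mul_swap_of_apply_left π hlr h1 (by omega)
      rw [h2, card_filter_box_eq fun i hi hi' => by
        have := h.cases i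
        omega] at d
      have h3 : IsThreeRuns (π * swap l r) (lo + 1) (K - 2) 0 0 := by
        have key : ∀ x, ((x = l ∨ x = r) ∧ (π * swap l r) x = x) ∨
            (x ≠ l ∧ x ≠ r ∧ (π * swap l r) x = π x) := by
          intro x
          by_cases hx : x = l
          · subst hx; simp [h2]
          · by_cases hx' : x = r
            · subst hx'; simp [h1]
            · exact Or.inr ⟨hx, hx', by rw [mul_apply, swap_apply_of_ne_of_ne hx hx']⟩
        constructor <;> intro x <;> have c1 := key x <;> have c2 := h.cases x <;> omega
      have h4 := (isShallow_iff_defect _).1 (ih (K - 2) (by omega) h3 (by omega))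
      rw [isShallow_iff_defect]
      omega

theorem isShallow_of_mid_eq_zero (h : IsThreeRuns π lo K a 0) (hN : lo + K + a ≤ N) :
    IsShallow π := by
  refine isShallow_of_zero (lo := lo) (K := K + a) ?_ (by omega)
  constructor <;> intro x <;> have c := h.cases x <;> omega

theorem mul_swap_mul_swap_cases {l q r : Fin N} (hq : l < q) (hr : q < r) (h1 : π l = r)
    (h2 : π q = l) (x : Fin N) :
    (x = l ∧ (π * swap l q * swap q r) x = l) ∨ (x = q ∧ (π * swap l q * swap q r) x = π r) ∨
      (x = r ∧ (π * swap l q * swap q r) x = r) ∨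
      (x ≠ l ∧ x ≠ q ∧ x ≠ r ∧ (π * swap l q * swap q r) x = π x) := by
  simp only [mul_apply]
  by_cases e1 : x = l
  · subst e1
    exact Or.inl ⟨rfl, by
      rw [swap_apply_of_ne_of_ne (a := q) (by omega) (by omega), swap_apply_left, h2]⟩
  by_cases e2 : x = q
  · subst e2
    exact Or.inr (Or.inl ⟨rfl, by
      rw [swap_apply_left, swap_apply_of_ne_of_ne (by omega) (by omega)]⟩)
  by_cases e3 : x = r
  · subst e3
    exact Or.inr (Or.inr (Or.inl ⟨rfl, by rw [swap_apply_right, swap_apply_right, h1]⟩))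
  · exact Or.inr (Or.inr (Or.inr ⟨e1, e2, e3, by
      rw [swap_apply_of_ne_of_ne e2 e3, swap_apply_of_ne_of_ne e1 e2]⟩))

theorem cases_zero (h : IsThreeRuns π lo K 0 0) (x : Fin N) :
    (((x : ℕ) < lo ∨ lo + K ≤ x) ∧ (π x : ℕ) = x) ∨
    (lo ≤ x ∧ (x : ℕ) < lo + K ∧ (π x : ℕ) + x + 1 = 2 * lo + K) := by
  have := h.cases x
  omega

/-- This is the word left from K = 2 after one removal. It is a product of reversals of [lo + 1, lo
+ a], [lo + a, lo + a + 1] and [lo + a + 1, lo + a + b], consecutive ones sharing an end point. -/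
theorem isShallow_of_three_reversals {ρ : Perm (Fin N)} (ha : 1 ≤ a) (hb : 1 ≤ b)
    (hN : lo + a + b + 1 ≤ N)
    (h : ∀ x : Fin N, (((x : ℕ) ≤ lo ∨ lo + a + b < x) ∧ (ρ x : ℕ) = x) ∨
      ((x : ℕ) = lo + 1 ∧ (ρ x : ℕ) = lo + a + b) ∨
      (lo + 1 < x ∧ (x : ℕ) ≤ lo + a ∧ (ρ x : ℕ) + x = 2 * lo + a + 1) ∨
      ((x : ℕ) = lo + a + 1 ∧ (ρ x : ℕ) = lo + a) ∨
      (lo + a + 1 < x ∧ (x : ℕ) ≤ lo + a + b ∧ (ρ x : ℕ) + x = 2 * lo + 2 * a + b + 1)) :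
    IsShallow ρ := by
  obtain ⟨r₁, hr₁⟩ := exists_of_le (N := N) (lo := lo + 1) (K := a) (a := 0) (b := 0) (by omega)
  obtain ⟨r₂, hr₂⟩ := exists_of_le (N := N) (lo := lo + a) (K := 2) (a := 0) (b := 0) (by omega)
  obtain ⟨r₃, hr₃⟩ :=
    exists_of_le (N := N) (lo := lo + a + 1) (K := b) (a := 0) (b := 0) (by omega)
  have e : ρ = r₃ * (r₂ * r₁) := by
    ext x
    change (ρ x : ℕ) = r₃ (r₂ (r₁ x))
    have c4 := h x
    have c1 := hr₁.cases_zero x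
    have c2 := hr₂.cases_zero (r₁ x)
    have c3 := hr₃.cases_zero (r₂ (r₁ x))
    clear h
    rcases c1 with c1 | c1 <;> rcases c2 with c2 | c2 <;> rcases c3 with c3 | c3 <;>
      rcases c4 with c4 | c4 | c4 | c4 | c4 <;> omega
  obtain ⟨p, hp⟩ : ∃ p : Fin N, (p : ℕ) = lo + a := ⟨⟨lo + a, by omega⟩, rfl⟩
  obtain ⟨p', hp'⟩ : ∃ p : Fin N, (p : ℕ) = lo + a + 1 := ⟨⟨lo + a + 1, by omega⟩, rfl⟩
  rw [e, isShallow_wedge (p := p'), isShallow_wedge (p := p)]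
  · exact ⟨⟨hr₁.isShallow_of_zero (by omega), hr₂.isShallow_of_zero (by omega)⟩,
      hr₃.isShallow_of_zero (by omega)⟩
  · intro x hx
    have := hr₁.cases_zero x
    omega
  · intro x hx
    have := hr₂.cases_zero x
    omega
  · intro x hx
    have h1 := hr₁.cases_zero x
    have h2 := hr₂.cases_zero (r₁ x)
    rw [mul_apply]
    omega
  · intro x hx
    have := hr₃.cases_zero x
    omega

/-- The effect of removing the largest and the smallest value from a permutation with three
runs. -/
theorem exists_step (h : IsThreeRuns π lo K a b) (hK : 2 ≤ K) (ha : 1 ≤ a) (hb : 1 ≤ b)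
    (hN : lo + K + a + b ≤ N) : ∃ ρ : Perm (Fin N), (IsShallow π ↔ IsShallow ρ) ∧
      ∀ x : Fin N, (((x : ℕ) ≤ lo ∨ lo + K + a + b ≤ x + 1) ∧ (ρ x : ℕ) = x) ∨
        (lo < x ∧ (x : ℕ) < lo + K ∧ (ρ x : ℕ) + x + 1 = 2 * lo + K + a + b) ∨
        (lo + K ≤ x ∧ (x : ℕ) + 1 < lo + K + a ∧ (ρ x : ℕ) + x + 1 = 2 * lo + K + a) ∨
        ((x : ℕ) + 1 = lo + K + a ∧ (ρ x : ℕ) = lo + a) ∨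
        (lo + K + a ≤ x ∧ (x : ℕ) + 1 < lo + K + a + b ∧
          (ρ x : ℕ) + x + 1 = 2 * lo + K + 2 * a + b) := by
  obtain ⟨l, hl⟩ : ∃ l : Fin N, (l : ℕ) = lo := ⟨⟨lo, by omega⟩, rfl⟩
  obtain ⟨y, hy⟩ : ∃ y : Fin N, (y : ℕ) = lo + 1 := ⟨⟨lo + 1, by omega⟩, rfl⟩
  obtain ⟨q, hq⟩ : ∃ q : Fin N, (q : ℕ) + 1 = lo + K + a :=
    ⟨⟨lo + K + a - 1, by omega⟩, by simp only; omega⟩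
  obtain ⟨r, hr⟩ : ∃ r : Fin N, (r : ℕ) + 1 = lo + K + a + b :=
    ⟨⟨lo + K + a + b - 1, by omega⟩, by simp only; omega⟩
  have h1 : π l = r := by have := h.large l; omega
  have h2 : π q = l := by have := h.small q; omega
  have cy : (π y : ℕ) + 1 = r := by have := h.large y; omega
  have cr : (π r : ℕ) = lo + a := by have := h.mid r; omega
  have hlq : l < q := by omega
  have hqr : q < r := by omega
  refine ⟨π * swap l q * swap q r, ?_, fun x => ?_⟩
  -- The side condition holds because the last run decreases and so ends with its smallest value.
  · rw [isShallow_iff_mul_swap_mul_swap (fun x hx => h.fixed x (by omega)) h1 cy (by omega)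
      (by omega) h2 hqr, and_iff_left fun i hi hi' => ?_]
    have := h.mid i
    omega
  · rcases mul_swap_mul_swap_cases hlq hqr h1 h2 x with c | c | c | c
    · exact Or.inl ⟨by omega, by omega⟩
    · exact Or.inr (Or.inr (Or.inr (Or.inl ⟨by omega, by omega⟩)))
    · exact Or.inl ⟨by omega, by omega⟩
    · rw [c.2.2.2]
      rcases h.cases x with c' | c' | c' | c'
      · exact Or.inl ⟨by omega, c'.2⟩
      · exact Or.inr (Or.inl ⟨by omega, c'.2⟩)
      · exact Or.inr (Or.inr (Or.inl ⟨c'.1, by omega, c'.2.2⟩))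
      · exact Or.inr (Or.inr (Or.inr (Or.inr ⟨c'.1, by omega, c'.2.2⟩)))

/-- One removal puts the old last value lo + a right after the new minimum, while the new last value
is lo + a + 1. As K - 1 ≥ 2 the criterion applies again, and its side condition fails. -/
theorem not_isShallow (h : IsThreeRuns π lo K a b) (hK : 3 ≤ K) (ha : 2 ≤ a) (hb : 2 ≤ b)
    (hN : lo + K + a + b ≤ N) : ¬ IsShallow π := by
  obtain ⟨ρ, hρ, key⟩ := h.exists_step (by omega) (by omega) (by omega) hN
  obtain ⟨l, hl⟩ : ∃ y : Fin N, (y : ℕ) = lo + 1 := ⟨⟨lo + 1, by omega⟩, rfl⟩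
  obtain ⟨y, hy⟩ : ∃ y : Fin N, (y : ℕ) = lo + 2 := ⟨⟨lo + 2, by omega⟩, rfl⟩
  obtain ⟨q, hq⟩ : ∃ q : Fin N, (q : ℕ) + 2 = lo + K + a :=
    ⟨⟨lo + K + a - 2, by omega⟩, by simp only; omega⟩
  obtain ⟨s, hs⟩ : ∃ s : Fin N, (s : ℕ) = q + 1 := ⟨⟨q + 1, by omega⟩, rfl⟩
  obtain ⟨r, hr⟩ : ∃ r : Fin N, (r : ℕ) + 2 = lo + K + a + b :=
    ⟨⟨lo + K + a + b - 2, by omega⟩, by simp only; omega⟩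
  have vl : ρ l = r := by have := key l; omega
  have vy : (ρ y : ℕ) + 1 = r := by have := key y; omega
  have vq : ρ q = l := by have := key q; omega
  have vs : (ρ s : ℕ) = lo + a := by have := key s; omega
  have vr : (ρ r : ℕ) = lo + a + 1 := by have := key r; omega
  rw [hρ, isShallow_iff_mul_swap_mul_swap (fun x hx => by have := key x; omega) vl vy
    (by omega) (by omega) vq (by omega)]
  rintro ⟨-, hcon⟩
  have := hcon s (by omega) (by omega)
  omega

/-- A permutation with three runs is shallow if and only if at most two elements are in the first
run or one of the other runs is a singleton. -/
theorem isShallow_iff (h : IsThreeRuns π lo K a b) (hK : 2 ≤ K) (ha : 1 ≤ a) (hb : 1 ≤ b)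
    (hN : lo + K + a + b ≤ N) : IsShallow π ↔ K = 2 ∨ a = 1 ∨ b = 1 := by
  induction K using Nat.strong_induction_on generalizing lo a b π with
  | _ K ih =>
    obtain ⟨ρ, hρ, key⟩ := h.exists_step hK ha hb hN
    by_cases hK2 : K = 2
    · subst hK2
      refine iff_of_true (hρ.2 (isShallow_of_three_reversals (lo := lo) ha hb (by omega)
        fun x => ?_)) (Or.inl rfl)
      have := key x
      omega
    · by_cases ha1 : a = 1
      · subst ha1
        refine iff_of_true (hρ.2 ?_) (Or.inr (Or.inl rfl))
        -- For a = 1 the value moved to the end of the second run is the new minimum, so that run is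
        -- again a singleton.
        have h3 : IsThreeRuns ρ (lo + 1) (K - 1) 1 (b - 1) := by
          constructor <;> intro x <;> have c := key x <;> omega
        by_cases hb1 : b = 1
        · rw [hb1] at h3
          exact h3.isShallow_of_mid_eq_zero (by omega)
        · exact (ih (K - 1) (by omega) h3 (by omega) le_rfl (by omega) (by omega)).2
            (Or.inr (Or.inl rfl))
      · by_cases hb1 : b = 1
        · subst hb1
          refine iff_of_true (hρ.2 ?_) (Or.inr (Or.inr rfl))
          -- For b = 1 the moved value lo + a becomes the new last run.
          have h3 : IsThreeRuns ρ (lo + 1) (K - 1) (a - 1) 1 := by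
            constructor <;> intro x <;> have c := key x <;> omega
          exact (ih (K - 1) (by omega) h3 (by omega) (by omega) le_rfl (by omega)).2
            (Or.inr (Or.inr rfl))
        · exact iff_of_false (h.not_isShallow (by omega) (by omega) (by omega) hN) (by omega)

end IsThreeRuns

/-! ### Classification of the shallow 231-avoiders that start with their two largest values. -/

theorem card_filter_lt_eq {n : ℕ} (v : Fin n) : (Finset.univ.filter fun y => y < v).card = v := by
  rw [← Fin.card_Iio v]
  congr 1
  ext; simp

theorem card_filter_gt_eq {n : ℕ} (v : Fin n) :
    (Finset.univ.filter fun y => v < y).card = n - 1 - v := by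
  rw [← Fin.card_Ioi v]
  congr 1
  ext; simp

theorem card_filter_lt_le {n : ℕ} (a b : Fin n) :
    (Finset.univ.filter fun i => a < i ∧ i ≤ b).card = (b : ℕ) - a := by
  rw [← Fin.card_Ioc]
  congr 1
  ext; simp

theorem card_filter_le_lt {n : ℕ} (a b : Fin n) :
    (Finset.univ.filter fun i => a ≤ i ∧ i < b).card = (b : ℕ) - a := by
  rw [← Fin.card_Ico]
  congr 1
  ext; simp

theorem card_filter_eq_of_apply_iff {n : ℕ} (π : Perm (Fin n)) {P Q : Fin n → Prop}
    [DecidablePred P] [DecidablePred Q] (h : ∀ y, P y ↔ Q (π y)) :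
    (Finset.univ.filter P).card = (Finset.univ.filter Q).card := by
  rw [← card_filter_apply π Q]
  congr 1
  ext y
  simp [h]

/-- A `231`-avoiding permutation that decreases up to position `q`, decreases after position `q`,
and begins with its two largest values has three runs. -/
theorem isThreeRuns_of_antitone {n : ℕ} {π : Perm (Fin n)} (hav : Avoids231 π) {z y q r : Fin n}
    (hz : (z : ℕ) = 0) (hy : (y : ℕ) = 1) (hπy : (π y : ℕ) + 2 = n)
    (hyq : y < q) (hqr : q < r) (hr : (r : ℕ) + 1 = n) (hπq : π q = z)
    (hL : ∀ u v, u < v → v ≤ q → π v < π u) (hR : ∀ u v, q < u → u < v → π v < π u) :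
    ∃ K a b, 2 ≤ K ∧ 1 ≤ a ∧ 1 ≤ b ∧ K + a + b = n ∧ IsThreeRuns π 0 K a b := by
  have hinj : ∀ u v, u ≠ v → π u ≠ π v := fun u v h e => h (π.injective e)
  -- A value between π r and some later π v would give the pattern 231 at x, v, r. So the values
  -- after q fill an interval, and monotonicity determines every entry by counting.
  have hsep : ∀ x, x ≤ q → π x < π r ∨ ∀ v, q < v → π v < π x := by
    intro x hx
    by_contra! hcon
    obtain ⟨h1, v, h2, h3⟩ := hcon
    have h4 := hinj x r (by omega)
    have h5 := hinj x v (by omega)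
    have h6 : v ≠ r := by rintro rfl; omega
    exact hav ⟨x, v, r, by omega, by omega, by omega, by omega⟩
  have hRr : ∀ x, q < x → π r ≤ π x := fun x hx => by
    rcases eq_or_ne x r with rfl | hxr
    · exact le_rfl
    · exact (hR x r hx (by omega)).le
  have vR : ∀ x, q < x → (π x : ℕ) + x = π r + r := fun x hx => by
    have h1 := card_filter_eq_of_apply_iff π (P := fun v => x < v)
      (Q := fun v => π r ≤ v ∧ v < π x) fun v => by
      constructor
      · exact fun h => ⟨hRr v (hx.trans h), hR x v hx h⟩
      · rintro ⟨h1, h2⟩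
        rcases le_or_gt v q with hv | hv
        · rcases hsep v hv with h3 | h3
          · omega
          · have := h3 x hx
            omega
        · by_contra! hvx
          rcases hvx.lt_or_eq with h3 | h3
          · have := hR v x hv h3
            omega
          · subst h3
            omega
    rw [card_filter_gt_eq, card_filter_le_lt] at h1
    have := hRr x hx
    omega
  have vS : ∀ x, x ≤ q → π x < π r → (π x : ℕ) + x = q := fun x hx hxr => by
    have h1 := card_filter_eq_of_apply_iff π (P := fun v => x < v ∧ v ≤ q)
      (Q := fun v => v < π x) fun v => by
      constructor
      · exact fun h => hL x v h.1 h.2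
      · intro h2
        have hv : v ≤ q := by
          by_contra! hv
          have := hRr v hv
          omega
        refine ⟨?_, hv⟩
        by_contra! hvx
        rcases hvx.lt_or_eq with h3 | h3
        · have := hL v x h3 hx
          omega
        · subst h3
          omega
    rw [card_filter_lt_eq, card_filter_lt_le] at h1
    omega
  have vL : ∀ x, x ≤ q → (∀ v, q < v → π v < π x) → (π x : ℕ) + x + 1 = n := fun x hx hxr => by
    have h1 := card_filter_eq_of_apply_iff π (P := fun v => v < x)
      (Q := fun v => π x < v) fun v => by
      constructor
      · exact fun h => hL v x h hx
      · intro h2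
        have hv : v ≤ q := by
          by_contra! hv
          have := hxr v hv
          omega
        by_contra! hvx
        rcases hvx.lt_or_eq with h3 | h3
        · have := hL x v h3 hv
          omega
        · subst h3
          omega
    rw [card_filter_lt_eq, card_filter_gt_eq] at h1
    omega
  have ha : π r ≠ z := fun e => hinj r q hqr.ne' (e.trans hπq.symm)
  obtain ⟨s, hs⟩ : ∃ s : Fin n, (s : ℕ) = q + 1 := ⟨⟨q + 1, by omega⟩, rfl⟩
  have hsr := vR s (by omega)
  have hcase : ∀ x, x ≤ q → ((x : ℕ) + π r < q + 1 ∧ (π x : ℕ) + x + 1 = n) ∨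
      (q + 1 ≤ (x : ℕ) + π r ∧ (π x : ℕ) + x = q) := fun x hx => by
    rcases hsep x hx with h | h
    · have := vS x hx h
      omega
    · have := vL x hx h
      have := h s (by omega)
      omega
  have hK : (π r : ℕ) + 2 ≤ q + 1 := by
    have := hcase y (by omega)
    omega
  -- The small values are those below π r, and the middle run occupies the positions after q.
  refine ⟨q + 1 - π r, π r, r - q, by omega, by omega, by omega, by omega, ?_⟩
  constructor <;> intro x
  · intro hx
    omega
  · intro _ hx
    have := hcase x (by omega)
    omega
  · intro hx hx'
    have := hcase x (by omega)
    omega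
  · intro hx hx'
    have := vR x (by omega)
    omega

theorem isThreeRuns_of_isShallow {n : ℕ} {π : Perm (Fin n)} (hav : Avoids231 π)
    (hsh : IsShallow π) {z y r : Fin n} (hz : (z : ℕ) = 0) (hy : (y : ℕ) = 1)
    (hr : (r : ℕ) + 1 = n) (hπz : π z = r) (hπy : (π y : ℕ) + 1 = r) :
    IsThreeRuns π 0 n 0 0 ∨
    ∃ K a b, 2 ≤ K ∧ 1 ≤ a ∧ 1 ≤ b ∧ K + a + b = n ∧ IsThreeRuns π 0 K a b := by
  have hinj : ∀ u v, u ≠ v → π u ≠ π v := fun u v h e => h (π.injective e)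
  obtain ⟨q, hq⟩ : ∃ q, π q = z := ⟨π⁻¹ z, by simp⟩
  -- An ascent before the minimum would form a 231 with it. After q the last entry plays the same
  -- role, being the smallest there by the shallowness criterion.
  have hL : ∀ u v, u < v → v ≤ q → π v < π u := by
    intro u v huv hvq
    have h1 := hinj u q (by omega)
    by_cases hv : v = q
    · subst hv
      omega
    · by_contra! hcon
      have h2 := hinj u v huv.ne
      exact hav ⟨u, v, q, huv, by omega, by omega, by omega⟩
  by_cases hqr : q = r
  · left
    subst hqr
    constructor <;> intro x
    · intro hx
      omega
    · intro _ _
      have h1 := card_filter_eq_of_apply_iff π (P := fun v => v < x)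
        (Q := fun v => π x < v) fun v => by
        constructor
        · exact fun h => hL v x h (by omega)
        · intro h2
          by_contra! hvx
          rcases hvx.lt_or_eq with h3 | h3
          · have := hL x v h3 (by omega)
            omega
          · subst h3
            omega
      rw [card_filter_lt_eq, card_filter_gt_eq] at h1
      omega
    · omega
    · omega
  · right
    have hzq : q ≠ z := by rintro rfl; omega
    have hyq : q ≠ y := by rintro rfl; omega
    have hqr' : q < r := by omega
    have hcond := ((isShallow_iff_mul_swap_mul_swap (l := z) (y := y) (q := q) (h := r)
      (fun x hx => by omega) hπz hπy (by omega) (by omega) hq hqr').1 hsh).2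
    refine isThreeRuns_of_antitone hav hz hy (by omega) (by omega) hqr' hr hq hL
      fun u v hu huv => ?_
    by_cases hv : v = r
    · subst hv
      exact hcond u hu huv
    · by_contra! hcon
      have h2 := hinj u v huv.ne
      exact hav ⟨u, v, r, huv, by omega, hcond u hu (by omega), by omega⟩

/-! ### Descents of the three-run words and the values of `cCount`. -/

namespace IsThreeRuns

variable {n : ℕ} {π : Perm (Fin n)} {K a b : ℕ}

theorem cases_univ (h : IsThreeRuns π 0 K a b) (hn : K + a + b = n) (x : Fin n) :
    ((x : ℕ) < K ∧ (π x : ℕ) + x + 1 = n) ∨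
    (K ≤ x ∧ (x : ℕ) < K + a ∧ (π x : ℕ) + x + 1 = K + a) ∨
    (K + a ≤ x ∧ (π x : ℕ) + x + 1 = n + a) := by
  have := h.cases x
  omega

theorem avoids231 (h : IsThreeRuns π 0 K a b) (hn : K + a + b = n) : Avoids231 π := by
  rintro ⟨i, j, k, h1, h2, h3, h4⟩
  have c1 := h.cases_univ hn i
  have c2 := h.cases_univ hn j
  have c3 := h.cases_univ hn k
  omega

theorem descents_of_pos (h : IsThreeRuns π 0 K a b) (hn : K + a + b = n) (hK : 0 < K) (ha : 0 < a)
    (hb : 0 < b) : descents π + 2 = n := by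
  obtain ⟨q, hq⟩ : ∃ q : Fin n, (q : ℕ) + 1 = K + a := ⟨⟨K + a - 1, by omega⟩, by simp only; omega⟩
  obtain ⟨r, hr⟩ : ∃ r : Fin n, (r : ℕ) + 1 = n := ⟨⟨n - 1, by omega⟩, by simp only; omega⟩
  have hset : (Finset.univ.filter fun i : Fin n => ∃ h : (i : ℕ) + 1 < n,
      π ⟨(i : ℕ) + 1, h⟩ < π i) = (Finset.univ.erase q).erase r := by
    ext i
    simp only [Finset.mem_filter, Finset.mem_univ, true_and, Finset.mem_erase, and_true]
    by_cases hi : (i : ℕ) + 1 < n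
    · simp only [hi, exists_true_left]
      obtain ⟨y, hy⟩ : ∃ y : Fin n, y = ⟨i + 1, hi⟩ := ⟨_, rfl⟩
      have hy' : (y : ℕ) = i + 1 := by rw [hy]
      rw [← hy]
      have c1 := h.cases_univ hn i
      have c2 := h.cases_univ hn y
      omega
    · simp only [hi, IsEmpty.exists_iff, false_iff]
      omega
  rw [descents, hset, Finset.card_erase_of_mem (by simp; omega), Finset.card_erase_of_mem (by simp)]
  simp
  omega

theorem descents_of_zero (h : IsThreeRuns π 0 n 0 0) (hn : 0 < n) : descents π + 1 = n := by
  obtain ⟨r, hr⟩ : ∃ r : Fin n, (r : ℕ) + 1 = n := ⟨⟨n - 1, by omega⟩, by simp only; omega⟩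
  have hset : (Finset.univ.filter fun i : Fin n => ∃ h : (i : ℕ) + 1 < n,
      π ⟨(i : ℕ) + 1, h⟩ < π i) = Finset.univ.erase r := by
    ext i
    simp only [Finset.mem_filter, Finset.mem_univ, true_and, Finset.mem_erase, and_true]
    by_cases hi : (i : ℕ) + 1 < n
    · simp only [hi, exists_true_left]
      obtain ⟨y, hy⟩ : ∃ y : Fin n, y = ⟨i + 1, hi⟩ := ⟨_, rfl⟩
      have hy' : (y : ℕ) = i + 1 := by rw [hy]
      rw [← hy]
      have c1 := h.cases_univ rfl i
      have c2 := h.cases_univ rfl y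
      omega
    · simp only [hi, IsEmpty.exists_iff, false_iff]
      omega
  rw [descents, hset, Finset.card_erase_of_mem (by simp)]
  simp
  omega

theorem params_unique {K' a' b' : ℕ} (h : IsThreeRuns π 0 K a b) (hn : K + a + b = n)
    (h' : IsThreeRuns π 0 K' a' b') (hn' : K' + a' + b' = n) (ha : 0 < a)
    (ha' : 0 < a') (hb : 0 < b) (hb' : 0 < b') : a = a' ∧ b = b' := by
  obtain ⟨q, hq⟩ : ∃ q : Fin n, (q : ℕ) + 1 = K + a := ⟨⟨K + a - 1, by omega⟩, by simp only; omega⟩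
  obtain ⟨r, hr⟩ : ∃ r : Fin n, (r : ℕ) + 1 = n := ⟨⟨n - 1, by omega⟩, by simp only; omega⟩
  have c1 := h.cases_univ hn q
  have c2 := h.cases_univ hn r
  have c3 := h'.cases_univ hn' q
  have c4 := h'.cases_univ hn' r
  omega

end IsThreeRuns

/-- The run lengths `(a, b)` of the shallow permutations of length `n` with three runs. -/
def runLengths (n : ℕ) : Finset (ℕ × ℕ) :=
  (Finset.range n ×ˢ Finset.range n).filter fun p =>
    1 ≤ p.1 ∧ 1 ≤ p.2 ∧ p.1 + p.2 + 2 ≤ n ∧ (p.1 + p.2 + 2 = n ∨ p.1 = 1 ∨ p.2 = 1)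

theorem card_runLengths (n : ℕ) : (runLengths n).card = (n - 3) + (n - 4) + (n - 5) := by
  -- The three sets are K = 2; a = 1 with K ≥ 3; and b = 1 with a ≥ 2 and K ≥ 3. Truncated
  -- subtraction makes them empty for small n.
  have h : runLengths n = (Finset.Icc 1 (n - 3)).image (fun a => (a, n - 2 - a)) ∪
      ((Finset.Icc 1 (n - 4)).image (fun b => (1, b)) ∪
        (Finset.Icc 2 (n - 4)).image (fun a => (a, 1))) := by
    ext ⟨a, b⟩
    simp only [runLengths, Finset.mem_filter, Finset.mem_product, Finset.mem_range,
      Finset.mem_union, Finset.mem_image, Finset.mem_Icc, Prod.mk.injEq]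
    constructor
    · rintro ⟨-, h1, h2, h3, h4⟩
      by_cases h5 : a + b + 2 = n
      · exact Or.inl ⟨a, by omega, rfl, by omega⟩
      · by_cases h6 : a = 1
        · exact Or.inr (Or.inl ⟨b, by omega, h6.symm, rfl⟩)
        · exact Or.inr (Or.inr ⟨a, by omega, rfl, by omega⟩)
    · rintro (⟨c, h1, h2, h3⟩ | ⟨c, h1, h2, h3⟩ | ⟨c, h1, h2, h3⟩) <;> omega
  rw [h, Finset.card_union_of_disjoint, Finset.card_union_of_disjoint,
    Finset.card_image_of_injective, Finset.card_image_of_injective, Finset.card_image_of_injective,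
    Nat.card_Icc, Nat.card_Icc, Nat.card_Icc]
  · omega
  · exact fun a b h => congrArg Prod.fst h
  · exact fun a b h => congrArg Prod.snd h
  · exact fun a b h => congrArg Prod.fst h
  · rw [Finset.disjoint_left]
    rintro ⟨a, b⟩ h1 h2
    simp only [Finset.mem_image, Finset.mem_Icc, Prod.mk.injEq] at h1 h2
    omega
  · rw [Finset.disjoint_left]
    rintro ⟨a, b⟩ h1 h2
    simp only [Finset.mem_union, Finset.mem_image, Finset.mem_Icc, Prod.mk.injEq] at h1 h2
    omega

theorem cCount_mem_iff {n k : ℕ} (hn : 2 ≤ n) (π : Perm (Fin n)) :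
    (IsShallow π ∧ Avoids231 π ∧ descents π = k ∧ StartsWithMaxTwo π) ↔
      (k + 1 = n ∧ IsThreeRuns π 0 n 0 0) ∨
      (k + 2 = n ∧ ∃ p ∈ runLengths n, IsThreeRuns π 0 (n - p.1 - p.2) p.1 p.2) := by
  constructor
  · rintro ⟨h1, h2, h3, h4⟩
    rw [startsWithMaxTwo_iff (show 1 < n by omega)] at h4
    obtain ⟨r, hr⟩ : ∃ r : Fin n, (r : ℕ) + 1 = n := ⟨⟨n - 1, by omega⟩, by simp only; omega⟩
    rcases isThreeRuns_of_isShallow h2 h1 (z := ⟨0, by omega⟩) (y := ⟨1, by omega⟩) rfl rfl hr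
      (by omega) (by omega) with h | ⟨K, a, b, hK, ha, hb, hn', h⟩
    · have := h.descents_of_zero (by omega)
      exact Or.inl ⟨by omega, h⟩
    · have h5 := h.descents_of_pos hn' (by omega) (by omega) (by omega)
      have h6 := (h.isShallow_iff hK ha hb (by omega)).1 h1
      refine Or.inr ⟨by omega, (a, b), ?_, ?_⟩
      · simp only [runLengths, Finset.mem_filter, Finset.mem_product, Finset.mem_range]
        omega
      · rwa [show n - a - b = K by omega]
  · rw [startsWithMaxTwo_iff (show 1 < n by omega)]
    rintro (⟨hk, h⟩ | ⟨hk, ⟨a, b⟩, hp, h⟩)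
    · have h1 := h.descents_of_zero (by omega)
      have h2 := h.cases_univ rfl ⟨0, by omega⟩
      have h3 := h.cases_univ rfl ⟨1, by omega⟩
      simp only at h2 h3
      exact ⟨h.isShallow_of_zero (by omega), h.avoids231 rfl, by omega, by omega, by omega⟩
    · simp only [runLengths, Finset.mem_filter, Finset.mem_product, Finset.mem_range] at hp h
      have hn' : n - a - b + a + b = n := by omega
      have h1 := h.descents_of_pos hn' (by omega) (by omega) (by omega)
      have h2 := h.cases_univ hn' ⟨0, by omega⟩
      have h3 := h.cases_univ hn' ⟨1, by omega⟩
      simp only at h2 h3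
      exact ⟨(h.isShallow_iff (by omega) (by omega) (by omega) (by omega)).2 (by omega),
        h.avoids231 hn', by omega, by omega, by omega⟩

theorem cCount_eq {n : ℕ} (hn : 2 ≤ n) (k : ℕ) :
    cCount n k = if k + 1 = n then 1 else if k + 2 = n then (n - 3) + (n - 4) + (n - 5) else 0 := by
  classical
  rw [cCount]
  simp only [cCount_mem_iff hn]
  split_ifs with h1 h2
  · obtain ⟨π, hπ⟩ := IsThreeRuns.exists_of_le (N := n) (lo := 0) (K := n) (a := 0) (b := 0)
      (by omega)
    rw [Finset.card_eq_one]
    refine ⟨π, ?_⟩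
    ext ρ
    simp only [Finset.mem_filter, Finset.mem_univ, true_and, Finset.mem_singleton]
    constructor
    · rintro (h | h)
      · exact h.2.unique hπ
      · omega
    · rintro rfl
      exact Or.inl ⟨h1, hπ⟩
  · rw [← card_runLengths]
    symm
    have hle : ∀ p ∈ runLengths n, 0 + (n - p.1 - p.2) + p.1 + p.2 = n ∧ 1 ≤ p.1 ∧ 1 ≤ p.2 := by
      intro p hp
      simp only [runLengths, Finset.mem_filter, Finset.mem_product, Finset.mem_range] at hp
      omega
    choose! F hF using fun p hp => IsThreeRuns.exists_of_le (N := n) (hle p hp).1.le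
    refine Finset.card_bij (fun p _ => F p) ?_ ?_ ?_
    · intro p hp
      simp only [Finset.mem_filter, Finset.mem_univ, true_and]
      exact Or.inr ⟨h2, p, hp, hF p hp⟩
    · intro p hp p' hp' he
      have e1 := hle p hp
      have e2 := hle p' hp'
      have e3 := hF p hp
      rw [he] at e3
      have := e3.params_unique (by omega) (hF p' hp') (by omega) (by omega) (by omega) (by omega)
        (by omega)
      exact Prod.ext this.1 this.2
    · intro π hπ
      simp only [Finset.mem_filter, Finset.mem_univ, true_and] at hπ
      rcases hπ with h | ⟨-, p, hp, h⟩
      · omega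
      · exact ⟨p, hp, (hF p hp).unique h⟩
  · rw [Finset.card_eq_zero, Finset.filter_eq_empty_iff]
    rintro π - (h | h) <;> omega

end ShallowPerm

namespace ShallowPerm

/-! ### Arithmetic of bivariate generating functions. -/

section GenFun

open MvPowerSeries

theorem coeff_genFun (a : ℕ → ℕ → ℕ) (m : Fin 2 →₀ ℕ) :
    coeff m (genFun a) = (a (m 0) (m 1) : ℚ) := rfl

theorem genFun_ext {a : ℕ → ℕ → ℕ} {f : MvPowerSeries (Fin 2) ℚ}
    (h : ∀ m : Fin 2 →₀ ℕ, coeff m f = (a (m 0) (m 1) : ℚ)) : f = genFun a :=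
  MvPowerSeries.ext h

theorem finsupp_fin_two_eq_iff (m m' : Fin 2 →₀ ℕ) : m = m' ↔ m 0 = m' 0 ∧ m 1 = m' 1 := by
  rw [Finsupp.ext_iff, Fin.forall_fin_two]

theorem genFun_add (a b : ℕ → ℕ → ℕ) :
    genFun a + genFun b = genFun fun n k => a n k + b n k :=
  genFun_ext fun m => by simp [coeff_genFun]

theorem genFun_mul (a b : ℕ → ℕ → ℕ) :
    genFun a * genFun b = genFun fun n k => ∑ p ∈ Finset.HasAntidiagonal.antidiagonal n,
      ∑ q ∈ Finset.HasAntidiagonal.antidiagonal k, a p.1 q.1 * b p.2 q.2 := by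
  refine genFun_ext fun m => ?_
  classical
  rw [coeff_mul]
  push_cast
  rw [← Finset.sum_product']
  refine Finset.sum_bij (fun x _ => ((x.1 0, x.2 0), (x.1 1, x.2 1))) ?_ ?_ ?_ ?_
  · rintro ⟨u, v⟩ h
    simp only [Finset.HasAntidiagonal.mem_antidiagonal, Finset.mem_product] at h ⊢
    subst h
    exact ⟨rfl, rfl⟩
  · rintro ⟨u, v⟩ _ ⟨u', v'⟩ _ h
    simp only [Prod.mk.injEq] at h ⊢
    rw [finsupp_fin_two_eq_iff, finsupp_fin_two_eq_iff]
    tauto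
  · rintro ⟨⟨i, j⟩, ⟨i', j'⟩⟩ h
    simp only [Finset.HasAntidiagonal.mem_antidiagonal, Finset.mem_product] at h
    refine ⟨(Finsupp.equivFunOnFinite.symm ![i, i'], Finsupp.equivFunOnFinite.symm ![j, j']), ?_,
      by simp⟩
    rw [Finset.HasAntidiagonal.mem_antidiagonal, finsupp_fin_two_eq_iff]
    simpa using h
  · rintro ⟨u, v⟩ _
    rfl

theorem X_pow_mul_X_pow_mul_genFun (i j : ℕ) (a : ℕ → ℕ → ℕ) :
    X 0 ^ i * X 1 ^ j * genFun a =
      genFun fun n k => if i ≤ n ∧ j ≤ k then a (n - i) (k - j) else 0 := by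
  refine genFun_ext fun m => ?_
  classical
  rw [X_pow_eq, X_pow_eq, monomial_mul_monomial, coeff_monomial_mul]
  have h : (Finsupp.single (0 : Fin 2) i + Finsupp.single 1 j ≤ m) ↔ i ≤ m 0 ∧ j ≤ m 1 := by
    rw [Finsupp.le_def, Fin.forall_fin_two]
    simp
  simp only [h]
  split_ifs
  · rw [coeff_genFun]
    simp
  · simp

theorem X_pow_mul_X_pow (i j : ℕ) : (X 0 ^ i * X 1 ^ j : MvPowerSeries (Fin 2) ℚ) =
    genFun fun n k => if n = i ∧ k = j then 1 else 0 := by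
  refine genFun_ext fun m => ?_
  classical
  rw [X_pow_eq, X_pow_eq, monomial_mul_monomial, coeff_monomial]
  simp [finsupp_fin_two_eq_iff]

theorem genFun_geometric : (1 - X 0 * X 1) * genFun (fun n k => if n = k then 1 else 0) = 1 := by
  have h1 := X_pow_mul_X_pow_mul_genFun 1 1 (fun n k => if n = k then 1 else 0)
  have h2 := X_pow_mul_X_pow 0 0
  rw [pow_one, pow_one] at h1
  rw [pow_zero, pow_zero, one_mul] at h2
  rw [sub_mul, one_mul, h1, h2, sub_eq_iff_eq_add, genFun_add]
  congr 1
  ext n k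
  split_ifs <;> omega

theorem genFun_geometric_sq : (1 - X 0 * X 1) * genFun (fun n k => if n = k then n + 1 else 0) =
    genFun (fun n k => if n = k then 1 else 0) := by
  have h1 := X_pow_mul_X_pow_mul_genFun 1 1 (fun n k => if n = k then n + 1 else 0)
  rw [pow_one, pow_one] at h1
  rw [sub_mul, one_mul, h1, sub_eq_iff_eq_add, genFun_add]
  congr 1
  ext n k
  split_ifs <;> omega

end GenFun

/-! ### Initial values and the functional equations. -/

theorem cCount_of_lt_two {n : ℕ} (hn : n < 2) (k : ℕ) : cCount n k = 0 := by
  classical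
  rw [cCount, Finset.card_eq_zero, Finset.filter_eq_empty_iff]
  rintro π - ⟨-, -, -, -, h, -⟩
  omega

theorem bCount_zero (k : ℕ) : bCount 0 k = 0 := by
  classical
  rw [bCount, Finset.card_eq_zero, Finset.filter_eq_empty_iff]
  rintro π - ⟨-, -, -, h, -⟩
  omega

theorem isShallow_one {n : ℕ} : IsShallow (1 : Equiv.Perm (Fin n)) := by
  rw [isShallow_iff_defect, defect_one]

theorem bCount_one (k : ℕ) : bCount 1 k = if k = 0 then 1 else 0 := by
  classical
  have h1 : Avoids231 (1 : Equiv.Perm (Fin 1)) := by rintro ⟨i, j, k, h, -⟩; omega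
  have h2 : descents (1 : Equiv.Perm (Fin 1)) = 0 := by
    rw [descents, Finset.card_eq_zero, Finset.filter_eq_empty_iff]
    rintro i - ⟨h, -⟩
    omega
  have h3 : StartsWithMax (1 : Equiv.Perm (Fin 1)) := ⟨one_pos, rfl⟩
  rw [bCount, Finset.filter_congr (q := fun _ => k = 0)]
  · split_ifs with hk <;> simp [hk]
  · intro π _
    rw [Subsingleton.elim π 1, h2]
    simp [isShallow_one, h1, h3, eq_comm]

theorem tCount_zero (k : ℕ) : tCount 0 k = if k = 0 then 1 else 0 := by
  classical
  have h1 : Avoids231 (1 : Equiv.Perm (Fin 0)) := by rintro ⟨i, -⟩; exact i.elim0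
  have h2 : descents (1 : Equiv.Perm (Fin 0)) = 0 := rfl
  rw [tCount, Finset.filter_congr (q := fun _ => k = 0)]
  · split_ifs with hk <;> simp [hk]
  · intro π _
    rw [Subsingleton.elim π 1, h2]
    simp [isShallow_one, h1, eq_comm]

open MvPowerSeries

theorem genFun_tCount : genFun tCount = 1 + genFun tCount * genFun bCount := by
  have h0 := X_pow_mul_X_pow 0 0
  rw [pow_zero, pow_zero, one_mul] at h0
  rw [h0, genFun_mul, genFun_add]
  congr 1
  ext n k
  rcases Nat.eq_zero_or_pos n with rfl | hn
  · simp [tCount_zero, bCount_zero]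
  · rw [tCount_eq_sum hn, if_neg (by omega), zero_add,
      Finset.Nat.sum_antidiagonal_eq_sum_range_succ (fun i j =>
        ∑ q ∈ Finset.HasAntidiagonal.antidiagonal k, tCount i q.1 * bCount j q.2),
      Finset.sum_range_succ, Nat.sub_self]
    simp only [bCount_zero, mul_zero, Finset.sum_const_zero, add_zero]
    rw [Finset.sum_range]

/-- For n ≥ 5 the number (n - 3) + (n - 4) + (n - 5) equals 3(n - 4), which gives the squared
geometric series; the single word with n = 4 gives the isolated monomial. -/
theorem genFun_cCount : genFun cCount = X 0 ^ 4 * X 1 ^ 2 +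
    X 0 ^ 2 * X 1 ^ 1 * genFun (fun n k => if n = k then 1 else 0) +
    X 0 ^ 5 * X 1 ^ 3 * genFun (fun n k => if n = k then n + 1 else 0) * 3 := by
  rw [show ∀ f : MvPowerSeries (Fin 2) ℚ, f * 3 = f + f + f from fun f => by ring,
    X_pow_mul_X_pow_mul_genFun, X_pow_mul_X_pow_mul_genFun, X_pow_mul_X_pow]
  simp only [genFun_add]
  congr 1
  ext n k
  rcases lt_or_ge n 2 with hn | hn
  · rw [cCount_of_lt_two hn]
    split_ifs <;> omega
  · rw [cCount_eq hn]
    split_ifs <;> omega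

/-- The factor xt compensates for the shared point and the lost descent, and keeps the identity
inside the power series ring. -/
theorem genFun_bCount : X 0 * X 1 * (genFun bCount - X 0 - genFun cCount) =
    (genFun bCount - X 0) * genFun cCount := by
  set b' : ℕ → ℕ → ℕ := fun n k => if 2 ≤ n then bCount n k else 0 with hb'
  set e : ℕ → ℕ → ℕ := fun n k => if 2 ≤ n then ∑ j : Fin n, if 2 ≤ (j : ℕ) then
      ∑ q ∈ Finset.HasAntidiagonal.antidiagonal (k + 1), bCount j q.1 * cCount (n + 1 - j) q.2
      else 0 else 0 with he
  have h1 : genFun bCount - X 0 = genFun b' := by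
    have h0 := X_pow_mul_X_pow 1 0
    rw [pow_zero, mul_one, pow_one] at h0
    rw [h0, sub_eq_iff_eq_add, genFun_add]
    congr 1
    ext n k
    rcases n with _ | _ | n
    · simp [hb', bCount_zero]
    · simp [hb', bCount_one]
    · simp [hb']
  have h2 : genFun b' - genFun cCount = genFun e := by
    rw [sub_eq_iff_eq_add, genFun_add]
    congr 1
    ext n k
    simp only [hb', he]
    split_ifs with hn
    · rw [bCount_eq_sum hn, add_comm]
    · rw [cCount_of_lt_two (by omega)]
  have h3 := X_pow_mul_X_pow_mul_genFun 1 1 e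
  rw [pow_one, pow_one] at h3
  -- The left side is divisible by t, so the product must have no term of degree 0 in t.
  have hc0 : ∀ n, cCount n 0 = 0 := fun n => by
    rcases lt_or_ge n 2 with hn | hn
    · exact cCount_of_lt_two hn 0
    · rw [cCount_eq hn]
      split_ifs <;> omega
  rw [h1, h2, h3, genFun_mul]
  congr 1
  ext n k
  rw [Finset.Nat.sum_antidiagonal_eq_sum_range_succ (fun i j =>
        ∑ q ∈ Finset.HasAntidiagonal.antidiagonal k, b' i q.1 * cCount j q.2)]
  rcases k with _ | k
  · simp [hc0]
  rcases n with _ | n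
  · simp [hb']
  rw [if_pos (by omega), Finset.sum_range_succ, Finset.sum_range_succ, Finset.sum_range]
  simp only [Nat.add_sub_cancel]
  -- The convolution has two more terms than the sum over `Fin n`; in both the second factor has
  -- length below 2.
  have h4 : ∀ m, m < 2 → ∀ i, ∑ q ∈ Finset.HasAntidiagonal.antidiagonal (k + 1),
      b' i q.1 * cCount m q.2 = 0 := fun m hm i => by
    simp [cCount_of_lt_two hm]
  rw [h4 (n + 1 - n) (by omega), h4 (n + 1 - (n + 1)) (by omega), add_zero, add_zero]
  simp only [he]
  split_ifs with hn
  · refine Finset.sum_congr rfl fun j _ => ?_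
    simp only [hb']
    split_ifs <;> simp
  · symm
    refine Finset.sum_eq_zero fun j _ => ?_
    have : ¬ 2 ≤ (j : ℕ) := by omega
    simp [hb', this]

/-! ### Passage to the field of fractions. -/

theorem toField_injective : Function.Injective toField :=
  IsFractionRing.injective (MvPowerSeries (Fin 2) ℚ) SeriesField

theorem toField_ne_zero_of_constantCoeff {f : MvPowerSeries (Fin 2) ℚ}
    (h : constantCoeff f ≠ 0) : toField f ≠ 0 := by
  intro h0
  rw [← map_zero toField] at h0
  rw [toField_injective h0] at h
  simp at h

theorem toField_X_ne_zero (i : Fin 2) : toField (X i) ≠ 0 := by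
  intro h0
  rw [← map_zero toField] at h0
  have := congrArg (coeff (Finsupp.single i 1)) (toField_injective h0)
  simp at this

end ShallowPerm

theorem mainTheorem9 :
    (1 - xVar * tVar ≠ 0 ∧
      genC = tVar ^ 2 * xVar ^ 4 + tVar * xVar ^ 2 / (1 - xVar * tVar)
        + 3 * tVar ^ 3 * xVar ^ 5 / (1 - xVar * tVar) ^ 2) ∧
    (xVar ≠ 0 ∧ tVar ≠ 0 ∧ 1 - 1 / (xVar * tVar) * genC ≠ 0 ∧
      genB = (xVar + genC - 1 / tVar * genC) / (1 - 1 / (xVar * tVar) * genC)) ∧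
    (1 - genB ≠ 0 ∧ genT = 1 / (1 - genB)) := by
  have hx : xVar ≠ 0 := toField_X_ne_zero 0
  have ht : tVar ≠ 0 := toField_X_ne_zero 1
  have hxt : 1 - xVar * tVar ≠ 0 := by
    have := toField_ne_zero_of_constantCoeff (f := 1 - MvPowerSeries.X 0 * MvPowerSeries.X 1)
      (by simp)
    simpa [xVar, tVar] using this
  have hB : 1 - genB ≠ 0 := by
    have := toField_ne_zero_of_constantCoeff (f := 1 - genFun bCount) (by
      have h : MvPowerSeries.constantCoeff (genFun bCount) = 0 := by
        change ((bCount 0 0 : ℕ) : ℚ) = 0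
        rw [bCount_zero, Nat.cast_zero]
      simp [h])
    simpa [genB] using this
  obtain ⟨P, hP⟩ : ∃ P, P = genFun (fun n k => if n = k then 1 else 0) := ⟨_, rfl⟩
  obtain ⟨Q, hQ⟩ : ∃ Q, Q = genFun (fun n k => if n = k then n + 1 else 0) := ⟨_, rfl⟩
  have eP := genFun_geometric
  have eQ := genFun_geometric_sq
  have eC := genFun_cCount
  rw [← hP, ← hQ] at eC
  rw [← hP] at eP
  rw [← hP, ← hQ] at eQ
  have fP := congrArg toField eP
  have fQ := congrArg toField eQ
  have fC := congrArg toField eC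
  have fB := congrArg toField genFun_bCount
  have fT := congrArg toField genFun_tCount
  simp only [map_mul, map_sub, map_add, map_one, map_pow, map_ofNat] at fP fQ fC fB fT
  change (1 - xVar * tVar) * toField P = 1 at fP
  change (1 - xVar * tVar) * toField Q = toField P at fQ
  change genC = xVar ^ 4 * tVar ^ 2 + xVar ^ 2 * tVar ^ 1 * toField P +
    xVar ^ 5 * tVar ^ 3 * toField Q * 3 at fC
  change xVar * tVar * (genB - xVar - genC) = (genB - xVar) * genC at fB
  change genT = 1 + genT * genB at fT
  -- By the formula for C, the quotient C/(xt) is x times a power series, so this denominator is a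
  -- power series with constant term 1.
  have hC : 1 - 1 / (xVar * tVar) * genC ≠ 0 := by
    have h := toField_ne_zero_of_constantCoeff (f := 1 - MvPowerSeries.X 0 *
      (MvPowerSeries.X 0 ^ 2 * MvPowerSeries.X 1 + P +
        MvPowerSeries.X 0 ^ 3 * MvPowerSeries.X 1 ^ 2 * Q * 3)) (by simp)
    simp only [map_mul, map_sub, map_add, map_one, map_pow, map_ofNat] at h
    change 1 - xVar * (xVar ^ 2 * tVar + toField P + xVar ^ 3 * tVar ^ 2 * toField Q * 3) ≠ 0 at h
    convert h using 2
    rw [fC]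
    field_simp
  have gP : toField P = 1 / (1 - xVar * tVar) := by
    rw [eq_div_iff hxt]
    linear_combination fP
  have gQ : toField Q = 1 / (1 - xVar * tVar) ^ 2 := by
    rw [eq_div_iff (pow_ne_zero 2 hxt)]
    linear_combination (1 - xVar * tVar) * fQ + fP
  refine ⟨⟨hxt, ?_⟩, ⟨hx, ht, hC, ?_⟩, hB, ?_⟩
  · rw [fC, gP, gQ]
    ring
  · rw [eq_div_iff hC]
    field_simp
    linear_combination fB
  · rw [eq_div_iff hB]
    linear_combination fT
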